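/- **Conventions.** Manifolds are smooth, Hausdorff, second countable, finite dimensional (of constant dimension) and without boundary. In a Lie groupoid with source $s$, target $t$ and unit $\epsilon$, the product $xy$ is defined when $t(x)=s(y)$. For a Lie groupoid $\mathcal G\rightrightarrows M$ and a surjective submersion $p:M'\to M$, the pull-back $\mathcal G[p]=M'\times_{p,M,s}\mathcal G\times_{t,M,p}M'\rightrightarrows M'$ is the Lie groupoid with source and target the outer projections and product $(x,\gamma,y)(y,\gamma',z)=(x,\gamma\gamma',z)$; we identify $\mathcal G[p][r]$ with $\mathcal G[p\circ r]$. Let $\mathbf G\xrightarrow{\rho}\mathbf H$ be a crossed module of finite dimensional Lie groups: $\rho$ is a Lie group morphism and $\mathbf H$ acts smoothly on $\mathbf G$ by automorphisms, $(h,g)\mapsto h(g)$, with $\rho(h(g))=h\rho(g)h^{-1}$ and $\rho(g)(g')=gg'g^{-1}$. **Extensions.** A $\mathbf G\to\mathbf H$-extension of $\mathcal G\rightrightarrows M$ is a triple $(\mathcal R\xrightarrow{\varphi}\mathcal G,\ P\xrightarrow{\pi}M,\ \chi)$ where 1. $\varphi$ is a morphism of Lie groupoids over $\mathrm{id}_M$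 which is a surjective submersion and whose kernel $K=\varphi^{-1}(\epsilon(M))$ is a locally trivial bundle of Lie groups over $M$ with typical fibre $\mathbf G$; 2. $P$ is a (right) principal $\mathbf H$-bundle over $M$ with a smooth left action of $\mathcal R$ on $\pi$ (that is, $r\cdot p$ is defined when $t(r)=\pi(p)$, and $\pi(r\cdot p)=s(r)$) which commutes with the action of $\mathbf H$; 3. $\chi$ assigns to $p\in P$ a Lie group isomorphism $\chi(p):\mathbf G\to K_{\pi(p)}=\varphi^{-1}(\epsilon(\pi(p)))$, smoothly in $p$, such that $\chi(r\cdot p\cdot h)(g)=r\,\chi(p)(h(g))\,r^{-1}$ and $p\cdot\rho(g)=\chi(p)(g)\cdot p$ for all $g\in\mathbf G$, $h\in\mathbf H$, $p\in P$, $r\in\mathcal R$ with $t(r)=\pi(p)$. An isomorphism of two $\mathbf G\to\mathbf H$-extensions $(\mathcal R\xrightarrow{\varphi}\mathcal G,P,\chi)$ and $(\mathcal R'\xrightarrow{\varphi'}\mathcal G,P',\chi')$ of $\mathcal G$ is a pair of a Lie groupoid isomorphism $\Phi:\mathcal R\to\mathcal R'$ over $\mathrm{id}_M$ with $\varphi'\circ\Phi=\varphi$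 and a diffeomorphism $\Psi:P\to P'$ over $\mathrm{id}_M$ with $\Psi(r\cdot p\cdot h)=\Phi(r)\cdot\Psi(p)\cdot h$ and $\chi'(\Psi(p))=\Phi\circ\chi(p)$. The pull-back along a surjective submersion $p:M'\to M$ is the extension $(\mathcal R[p]\xrightarrow{\varphi[p]}\mathcal G[p],\ P\times_M M'\to M',\ \chi[p])$ of $\mathcal G[p]$, with $\varphi[p](x,r,y)=(x,\varphi(r),y)$, action $(n,r,n')\cdot(x,n')=(r\cdot x,n)$ and $\chi[p](x,n)(g)=(n,\chi(x)(g),n)$. **Gerbes.** A $\mathbf G\to\mathbf H$-extension over a Lie groupoid $B\rightrightarrows B_0$ consists of a surjective submersion $q:M\to B_0$ and a $\mathbf G\to\mathbf H$-extension of $B[q]\rightrightarrows M$. Its pull-back along a surjective submersion $p:M'\to M$ is the pulled back extension of $B[q][p]=B[q\circ p]$, together with $q\circ p$. Two extensions over $B$, with base maps $q:M\to B_0$ and $q':M'\to B_0$, are Morita equivalent if there are a manifold $M''$ and surjective submersions $p:M''\to M$, $p':M''\to M'$ with $q\circ p=q'\circ p'$ such that the pull-backs along $p$ and $p'$ are isomorphic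 extensions of $B[q\circ p]=B[q'\circ p']$. A $\mathbf G\to\mathbf H$-gerbe over $B\rightrightarrows B_0$ is a Morita equivalence class of $\mathbf G\to\mathbf H$-extensions over $B$. **Theorem.** Let $\mathcal M=(T,f,g,\Phi)$ be a Morita equivalence between Lie groupoids $B\rightrightarrows B_0$ and $B'\rightrightarrows B'_0$, that is, a manifold $T$, surjective submersions $f:T\to B_0$ and $g:T\to B_0'$, and an isomorphism of Lie groupoids $\Phi:B[f]\to B'[g]$ over $\mathrm{id}_T$. To an extension $E=(q,\mathcal R\xrightarrow{\varphi}B[q],P\to M,\chi)$ over $B$ associate the extension $$\mathcal M_*E=\bigl(g\circ\beta,\ \mathcal R[\alpha]\xrightarrow{\Phi'\circ\varphi[\alpha]}B'[g\circ\beta],\ P\times_M M_T\to M_T,\ \chi[\alpha]\bigr)$$ over $B'$, where $M_T=M\times_{q,B_0,f}T$ has projections $\alpha:M_T\to M$ and $\beta:M_T\to T$, and $\Phi':B[q\circ\alpha]\to B'[g\circ\beta]$ maps $(x,b,y)$ to $(x,b',y)$ with $\Phi(\beta(x),b,\beta(y))=(\beta(x),b',\beta(y))$. Then $[E]\mapsto[\mathcal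 M_*E]$ is a well-defined bijection from the $\mathbf G\to\mathbf H$-gerbes over $B\rightrightarrows B_0$ to the $\mathbf G\to\mathbf H$-gerbes over $B'\rightrightarrows B_0'$. Its inverse is the map $[E']\mapsto[(\mathcal M^{-1})_*E']$ induced by the inverse Morita equivalence $\mathcal M^{-1}=(T,g,f,\Phi^{-1})$. -/

import Mathlib

open Set Filter Topology
open scoped Manifold ContDiff

universe u

/-- A smooth manifold: Hausdorff, second countable, without boundary, of constant finite
dimension `dim`. -/
structure Mfd : Type (u + 1) where
  carrier : Type u
  dim : ℕ
  [top : TopologicalSpace carrier]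
  [charted : ChartedSpace (EuclideanSpace ℝ (Fin dim)) carrier]
  [smooth : IsManifold (𝓡 dim) ∞ carrier]
  [t2 : T2Space carrier]
  [sc : SecondCountableTopology carrier]

namespace Mfd

instance : CoeSort Mfd.{u} (Type u) := ⟨Mfd.carrier⟩

attribute [instance] Mfd.top Mfd.charted Mfd.smooth Mfd.t2 Mfd.sc

/-- Smooth (`C^∞`) maps between manifolds. -/
abbrev Smooth {M N : Mfd.{u}} (f : M → N) : Prop := ContMDiff (𝓡 M.dim) (𝓡 N.dim) ∞ f

/-- Smoothness at a point. -/
abbrev SmoothAt {M N : Mfd.{u}} (f : M → N) (x : M) : Prop :=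
  ContMDiffAt (𝓡 M.dim) (𝓡 N.dim) ∞ f x

/-- Submersions between manifolds. -/
abbrev Subm {M N : Mfd.{u}} (f : M → N) : Prop :=
  Manifold.IsSubmersion (𝓡 M.dim) (𝓡 N.dim) ∞ f

/-- Surjective submersions between manifolds. -/
structure SurjSubm {M N : Mfd.{u}} (f : M → N) : Prop where
  subm : Subm f
  surj : Function.Surjective f

end Mfd

open Mfd

/-- The set-theoretic fibre product of the maps `f` and `g`. For manifolds it is given the topology
induced from the product. -/
@[ext]
structure FPSet {X Y Z : Type u} (f : X → Z) (g : Y → Z) : Type u where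
  fst : X
  snd : Y
  eq : f fst = g snd

namespace FPSet

variable {M N P : Mfd.{u}} {f : M → P} {g : N → P}

/-- The inclusion of the fibre product in the product. -/
def toProd (z : FPSet f g) : M × N := (z.fst, z.snd)

instance : TopologicalSpace (FPSet f g) := TopologicalSpace.induced toProd inferInstance

theorem isEmbedding_toProd : IsEmbedding (toProd : FPSet f g → M × N) :=
  ⟨⟨rfl⟩, fun _ _ h => FPSet.ext (congrArg Prod.fst h) (congrArg Prod.snd h)⟩

instance : T2Space (FPSet f g) := isEmbedding_toProd.t2Space
instance : SecondCountableTopology (FPSet f g) :=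
  isEmbedding_toProd.isInducing.secondCountableTopology

theorem continuous_fst : Continuous fun z : FPSet f g => z.fst :=
  _root_.continuous_fst.comp isEmbedding_toProd.continuous
theorem continuous_snd : Continuous fun z : FPSet f g => z.snd :=
  _root_.continuous_snd.comp isEmbedding_toProd.continuous

/-- The dimension of the fibre product of `f : M → P` and `g : N → P`. -/
def fdim (M N P : Mfd.{u}) : ℕ := (M.dim - P.dim) + N.dim

/-- Auxiliary data at a point `z` of the fibre product of a submersion `f` with a smooth map `g`:
charts in which `f` is the projection `(u, v) ↦ u`, a chart of `N` and an identification of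
model spaces. -/
structure Pre (f : M → P) (g : N → P) (z : FPSet f g) where
  F : Type
  [i1 : NormedAddCommGroup F]
  [i2 : NormedSpace ℝ F]
  φ : OpenPartialHomeomorph M (EuclideanSpace ℝ (Fin M.dim))
  ψ : OpenPartialHomeomorph P (EuclideanSpace ℝ (Fin P.dim))
  η : OpenPartialHomeomorph N (EuclideanSpace ℝ (Fin N.dim))
  hφ : φ ∈ IsManifold.maximalAtlas (𝓡 M.dim) ∞ M
  hψ : ψ ∈ IsManifold.maximalAtlas (𝓡 P.dim) ∞ P
  hη : η ∈ IsManifold.maximalAtlas (𝓡 N.dim) ∞ N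
  mφ : z.fst ∈ φ.source
  mη : z.snd ∈ η.source
  sub : φ.source ⊆ f ⁻¹' ψ.source
  e : EuclideanSpace ℝ (Fin M.dim) ≃L[ℝ] (EuclideanSpace ℝ (Fin P.dim) × F)
  L : EuclideanSpace ℝ (Fin (fdim M N P)) ≃L[ℝ] (F × EuclideanSpace ℝ (Fin N.dim))
  he : ∀ w ∈ φ.target, ψ (f (φ.symm w)) = (e w).1

attribute [instance] Pre.i1 Pre.i2

theorem exists_pre (hf : Subm f) (z : FPSet f g) : Nonempty (Pre f g z) := by
  obtain ⟨F, i1, i2, h⟩ := hf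
  have h := h z.fst
  have hfd : FiniteDimensional ℝ (EuclideanSpace ℝ (Fin P.dim) × F) :=
    LinearEquiv.finiteDimensional h.equiv.toLinearEquiv
  have hF : FiniteDimensional ℝ F :=
    Module.Finite.of_surjective (LinearMap.snd ℝ (EuclideanSpace ℝ (Fin P.dim)) F)
      Prod.snd_surjective
  have hr : Module.finrank ℝ F = M.dim - P.dim := by
    have := h.equiv.toLinearEquiv.finrank_eq
    rw [Module.finrank_prod] at this
    simp at this
    omega
  refine ⟨{ F := F, φ := h.domChart, ψ := h.codChart, η := chartAt _ z.snd
            hφ := h.domChart_mem_maximalAtlas, hψ := h.codChart_mem_maximalAtlas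
            hη := IsManifold.chart_mem_maximalAtlas _
            mφ := h.mem_domChart_source, mη := mem_chart_source _ _
            sub := h.source_subset_preimage_source
            e := h.equiv
            L := ContinuousLinearEquiv.ofFinrankEq ?_
            he := ?_ }⟩
  · rw [Module.finrank_prod, hr, finrank_euclideanSpace_fin, finrank_euclideanSpace_fin]; rfl
  · intro w hw
    have hw' : w ∈ (h.domChart.extend (𝓡 M.dim)).target := by simpa using hw
    have := h.writtenInCharts hw'
    simpa using this

namespace Pre

variable {z : FPSet f g} (p : Pre f g z)

/-- The inverse chart, first component. -/
def a (w : EuclideanSpace ℝ (Fin (fdim M N P))) : M :=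
  p.φ.symm (p.e.symm (p.ψ (g (p.η.symm (p.L w).2)), (p.L w).1))

/-- The inverse chart, second component. -/
def b (w : EuclideanSpace ℝ (Fin (fdim M N P))) : N := p.η.symm (p.L w).2

/-- The image of the chart. -/
def tgt : Set (EuclideanSpace ℝ (Fin (fdim M N P))) :=
  {w | ((p.L w).2 ∈ p.η.target ∧ g (p.η.symm (p.L w).2) ∈ p.ψ.source) ∧
    p.e.symm (p.ψ (g (p.η.symm (p.L w).2)), (p.L w).1) ∈ p.φ.target}

theorem eq_of_mem {w} (hw : w ∈ p.tgt) : f (p.a w) = g (p.b w) := by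
  have h := p.he _ hw.2
  simp only [ContinuousLinearEquiv.apply_symm_apply] at h
  exact p.ψ.injOn (p.sub (p.φ.map_target hw.2)) hw.1.2 h

theorem tgt_aux (hg : Smooth g) : IsOpen {w | (p.L w).2 ∈ p.η.target ∧ g (p.η.symm (p.L w).2) ∈ p.ψ.source} ∧
    ContMDiffOn (𝓡 (fdim M N P)) (𝓡 N.dim) ∞ p.b
      {w | (p.L w).2 ∈ p.η.target ∧ g (p.η.symm (p.L w).2) ∈ p.ψ.source} ∧
    ContMDiffOn (𝓡 (fdim M N P)) (𝓡 M.dim) ∞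
      (fun w => p.e.symm (p.ψ (g (p.η.symm (p.L w).2)), (p.L w).1))
      {w | (p.L w).2 ∈ p.η.target ∧ g (p.η.symm (p.L w).2) ∈ p.ψ.source} := by
  have h2 : ContMDiff (𝓡 (fdim M N P)) (𝓡 N.dim) ∞ fun w => (p.L w).2 :=
    (contDiff_snd.comp p.L.contDiff).contMDiff
  have h1 : ContMDiff (𝓡 (fdim M N P)) 𝓘(ℝ, p.F) ∞ fun w => (p.L w).1 :=
    (contDiff_fst.comp p.L.contDiff).contMDiff
  have o1 : IsOpen {w | (p.L w).2 ∈ p.η.target} := p.η.open_target.preimage h2.continuous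
  have hb : ContMDiffOn (𝓡 (fdim M N P)) (𝓡 N.dim) ∞ p.b {w | (p.L w).2 ∈ p.η.target} :=
    (contMDiffOn_symm_of_mem_maximalAtlas p.hη).comp h2.contMDiffOn fun w hw => hw
  have hgb := hg.comp_contMDiffOn hb
  refine ⟨hgb.continuousOn.isOpen_inter_preimage o1 p.ψ.open_source,
    hb.mono fun w hw => hw.1, ?_⟩
  have hψ := (contMDiffOn_of_mem_maximalAtlas p.hψ).comp (hgb.mono fun w (hw : w ∈
    {w | (p.L w).2 ∈ p.η.target ∧ g (p.η.symm (p.L w).2) ∈ p.ψ.source}) => hw.1) fun w hw => hw.2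
  exact p.e.symm.contDiff.contMDiff.comp_contMDiffOn (hψ.prodMk_space h1.contMDiffOn)

theorem isOpen_tgt (hg : Smooth g) : IsOpen p.tgt :=
  (p.tgt_aux hg).2.2.continuousOn.isOpen_inter_preimage (p.tgt_aux hg).1 p.φ.open_target

theorem contMDiffOn_b (hg : Smooth g) : ContMDiffOn (𝓡 (fdim M N P)) (𝓡 N.dim) ∞ p.b p.tgt :=
  (p.tgt_aux hg).2.1.mono fun _ hw => hw.1

theorem contMDiffOn_a (hg : Smooth g) : ContMDiffOn (𝓡 (fdim M N P)) (𝓡 M.dim) ∞ p.a p.tgt :=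
  (contMDiffOn_symm_of_mem_maximalAtlas p.hφ).comp
    ((p.tgt_aux hg).2.2.mono fun _ hw => hw.1) fun _ hw => hw.2

theorem left_inv_aux {y : FPSet f g} (h1 : y.fst ∈ p.φ.source) (_ : y.snd ∈ p.η.source) :
    p.e.symm (p.ψ (g y.snd), (p.e (p.φ y.fst)).2) = p.φ y.fst := by
  rw [← y.eq, ContinuousLinearEquiv.symm_apply_eq]
  have h := p.he _ (p.φ.map_source h1)
  rw [p.φ.left_inv h1] at h
  rw [h]

open Classical in
/-- The chart of the fibre product associated with `p`. -/
noncomputable def chart (hg : Smooth g) : OpenPartialHomeomorph (FPSet f g)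
    (EuclideanSpace ℝ (Fin (fdim M N P))) where
  toFun y := p.L.symm ((p.e (p.φ y.fst)).2, p.η y.snd)
  invFun w := if h : w ∈ p.tgt then ⟨p.a w, p.b w, p.eq_of_mem h⟩ else z
  source := {y | y.fst ∈ p.φ.source ∧ y.snd ∈ p.η.source}
  target := p.tgt
  map_source' y hy := by
    have h := p.left_inv_aux hy.1 hy.2
    refine ⟨⟨?_, ?_⟩, ?_⟩
    · simpa using p.η.map_source hy.2
    · simpa [hy.2, ← y.eq] using p.sub hy.1
    · simpa [hy.2, h] using p.φ.map_source hy.1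
  map_target' w hw := by
    rw [dif_pos hw]
    exact ⟨p.φ.map_target hw.2, p.η.map_target hw.1.1⟩
  left_inv' y hy := by
    have h := p.left_inv_aux hy.1 hy.2
    have hm : p.L.symm ((p.e (p.φ y.fst)).2, p.η y.snd) ∈ p.tgt := by
      refine ⟨⟨?_, ?_⟩, ?_⟩
      · simpa using p.η.map_source hy.2
      · simpa [hy.2, ← y.eq] using p.sub hy.1
      · simpa [hy.2, h] using p.φ.map_source hy.1
    rw [dif_pos hm]
    apply FPSet.ext
    · simp [a, hy.2, h, hy.1]
    · simp [b, hy.2]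
  right_inv' w hw := by
    rw [dif_pos hw]
    simp [a, b, p.φ.right_inv hw.2, p.η.right_inv hw.1.1]
  open_source := (p.φ.open_source.preimage continuous_fst).inter
    (p.η.open_source.preimage continuous_snd)
  open_target := p.isOpen_tgt hg
  continuousOn_toFun := by
    apply p.L.symm.continuous.comp_continuousOn
    refine (_root_.continuous_snd.comp_continuousOn (p.e.continuous.comp_continuousOn
      (p.φ.continuousOn.comp continuous_fst.continuousOn fun y hy => hy.1))).prodMk
      (p.η.continuousOn.comp continuous_snd.continuousOn fun y hy => hy.2)
  continuousOn_invFun := by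
    have : ContinuousOn (fun w => (p.a w, p.b w)) p.tgt :=
      (p.contMDiffOn_a hg).continuousOn.prodMk (p.contMDiffOn_b hg).continuousOn
    refine isEmbedding_toProd.isInducing.continuousOn_iff.2 (this.congr fun w hw => ?_)
    simp [hw, toProd]

theorem chart_symm_fst (hg : Smooth g) {w} (hw : w ∈ p.tgt) : ((p.chart hg).symm w).fst = p.a w :=
  congrArg FPSet.fst (dif_pos hw)

theorem chart_symm_snd (hg : Smooth g) {w} (hw : w ∈ p.tgt) : ((p.chart hg).symm w).snd = p.b w :=
  congrArg FPSet.snd (dif_pos hw)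

/-- Maps with smooth components are smooth when read in the chart. -/
theorem contMDiffOn_chart_comp {E H X : Type*} [NormedAddCommGroup E] [NormedSpace ℝ E]
    [TopologicalSpace H] {I : ModelWithCorners ℝ E H} [TopologicalSpace X] [ChartedSpace H X]
    {a' : X → M} {b' : X → N} {s : Set X}
    (ha : ContMDiffOn I (𝓡 M.dim) ∞ a' s) (hb : ContMDiffOn I (𝓡 N.dim) ∞ b' s)
    (h1 : ∀ x ∈ s, a' x ∈ p.φ.source) (h2 : ∀ x ∈ s, b' x ∈ p.η.source) :
    ContMDiffOn I (𝓡 (fdim M N P)) ∞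
      (fun x => p.L.symm ((p.e (p.φ (a' x))).2, p.η (b' x))) s := by
  have k1 := (contMDiffOn_of_mem_maximalAtlas p.hφ).comp ha h1
  have k2 := (contMDiffOn_of_mem_maximalAtlas p.hη).comp hb h2
  have k3 := (contDiff_snd.comp p.e.contDiff).contMDiff.comp_contMDiffOn k1
  exact p.L.symm.contDiff.contMDiff.comp_contMDiffOn (k3.prodMk_space k2)

end Pre

section
variable (hf : Subm f) (hg : Smooth g)

/-- The chosen chart of the fibre product at `z`. -/
noncomputable def chartAtPt (z : FPSet f g) : OpenPartialHomeomorph (FPSet f g)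
    (EuclideanSpace ℝ (Fin (fdim M N P))) :=
  (exists_pre (g := g) hf z).some.chart hg

/-- The charts of the fibre product of a submersion and a smooth map. -/
@[reducible] noncomputable def chartedSpace :
    ChartedSpace (EuclideanSpace ℝ (Fin (fdim M N P))) (FPSet f g) where
  atlas := range (chartAtPt hf hg)
  chartAt := chartAtPt hf hg
  mem_chart_source z := ⟨(exists_pre (g := g) hf z).some.mφ, (exists_pre (g := g) hf z).some.mη⟩
  chart_mem_atlas z := mem_range_self z

theorem isManifold : @IsManifold ℝ _ _ _ _ _ _ (𝓡 (fdim M N P)) ∞ (FPSet f g) _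
    (chartedSpace hf hg) := by
  let := chartedSpace hf hg
  apply isManifold_of_contDiffOn
  rintro _ _ ⟨z, rfl⟩ ⟨z', rfl⟩
  set p := (exists_pre (g := g) hf z).some with hp
  set p' := (exists_pre (g := g) hf z').some with hp'
  have hz : chartAtPt hf hg z = p.chart hg := rfl
  have hz' : chartAtPt hf hg z' = p'.chart hg := rfl
  rw [hz, hz']
  simp only [modelWithCornersSelf_coe, modelWithCornersSelf_coe_symm, Set.range_id,
    Set.preimage_id_eq, id, Set.inter_univ, Function.comp_id, Function.id_comp]
  rw [← contMDiffOn_iff_contDiffOn]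
  set S := ((p.chart hg).symm ≫ₕ p'.chart hg).source with hS
  have hS1 : ∀ w ∈ S, w ∈ p.tgt := fun w hw => by
    have := hw.1
    exact this
  have hS2 : ∀ w ∈ S, p.a w ∈ p'.φ.source ∧ p.b w ∈ p'.η.source := fun w hw => by
    have h2 : ((p.chart hg).symm w).fst ∈ p'.φ.source ∧
      ((p.chart hg).symm w).snd ∈ p'.η.source := hw.2
    rwa [p.chart_symm_fst hg (hS1 w hw), p.chart_symm_snd hg (hS1 w hw)] at h2
  refine (p'.contMDiffOn_chart_comp ((p.contMDiffOn_a hg).mono hS1)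
    ((p.contMDiffOn_b hg).mono hS1) (fun w hw => (hS2 w hw).1) (fun w hw => (hS2 w hw).2)).congr ?_
  intro w hw
  change p'.L.symm ((p'.e (p'.φ ((p.chart hg).symm w).fst)).2,
    p'.η ((p.chart hg).symm w).snd) = _
  rw [p.chart_symm_fst hg (hS1 w hw), p.chart_symm_snd hg (hS1 w hw)]

end

end FPSet

/-- The fibre product of a submersion `f` and a smooth map `g`, as a manifold. -/
noncomputable def FP {M N P : Mfd.{u}} (f : M → P) (g : N → P) (hf : Subm f) (hg : Smooth g) :
    Mfd.{u} :=
  letI := FPSet.chartedSpace hf hg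
  letI := FPSet.isManifold hf hg
  { carrier := FPSet f g, dim := FPSet.fdim M N P }

namespace FP

section
variable {X Y Z : Type u} {f : X → Z} {g : Y → Z}

/-- The first projection. -/
def fst (z : FPSet f g) : X := FPSet.fst z
/-- The second projection. -/
def snd (z : FPSet f g) : Y := FPSet.snd z
theorem w (z : FPSet f g) : f (fst z) = g (snd z) := FPSet.eq z
/-- The point of the fibre product with given components. -/
def mk (a : X) (b : Y) (h : f a = g b) : FPSet f g := FPSet.mk a b h

@[simp] theorem fst_mk (a : X) (b : Y) (h : f a = g b) : fst (mk a b h : FPSet f g) = a := rfl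
@[simp] theorem snd_mk (a : X) (b : Y) (h : f a = g b) : snd (mk a b h : FPSet f g) = b := rfl
theorem ext {z z' : FPSet f g} (h1 : fst z = fst z') (h2 : snd z = snd z') : z = z' :=
  FPSet.ext h1 h2
end

variable {M N P : Mfd.{u}} {f : M → P} {g : N → P} {hf : Subm f} {hg : Smooth g}

theorem smooth_fst_snd : Smooth (M := FP f g hf hg) fst ∧ Smooth (M := FP f g hf hg) snd := by
  let := FPSet.chartedSpace hf hg
  have key : ∀ z : FPSet f g, ContMDiffAt (𝓡 (FPSet.fdim M N P)) (𝓡 M.dim) ∞ FPSet.fst z ∧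
      ContMDiffAt (𝓡 (FPSet.fdim M N P)) (𝓡 N.dim) ∞ (FPSet.snd : FPSet f g → N) z := by
    intro z
    set p := (FPSet.exists_pre (g := g) hf z).some with hp
    have hz : chartAt (EuclideanSpace ℝ (Fin (FPSet.fdim M N P))) z = p.chart hg := rfl
    have hm := mem_chart_source (EuclideanSpace ℝ (Fin (FPSet.fdim M N P))) z
    have ho := (chartAt (EuclideanSpace ℝ (Fin (FPSet.fdim M N P))) z).open_source.mem_nhds hm
    have hc : ContMDiffAt (𝓡 (FPSet.fdim M N P)) (𝓡 (FPSet.fdim M N P)) ∞ (p.chart hg) z := by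
      have := contMDiffAt_extChartAt (I := 𝓡 (FPSet.fdim M N P)) (n := ∞) (x := z)
      simpa [hz] using this
    have ht : p.chart hg z ∈ p.tgt := (p.chart hg).map_source (by rw [← hz]; exact hm)
    have hT := (p.isOpen_tgt hg).mem_nhds ht
    constructor
    · refine (((p.contMDiffOn_a hg).contMDiffAt hT).comp z hc).congr_of_eventuallyEq ?_
      filter_upwards [ho] with y hy
      rw [hz] at hy
      rw [Function.comp_apply, ← p.chart_symm_fst hg ((p.chart hg).map_source hy),
        (p.chart hg).left_inv hy]
    · refine (((p.contMDiffOn_b hg).contMDiffAt hT).comp z hc).congr_of_eventuallyEq ?_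
      filter_upwards [ho] with y hy
      rw [hz] at hy
      rw [Function.comp_apply, ← p.chart_symm_snd hg ((p.chart hg).map_source hy),
        (p.chart hg).left_inv hy]
  exact ⟨fun z => (key z).1, fun z => (key z).2⟩

theorem smooth_fst : Smooth (M := FP f g hf hg) fst := smooth_fst_snd.1
theorem smooth_snd : Smooth (M := FP f g hf hg) snd := smooth_fst_snd.2

section lift
variable {E H X : Type*} [NormedAddCommGroup E] [NormedSpace ℝ E]
    [TopologicalSpace H] {I : ModelWithCorners ℝ E H} [TopologicalSpace X] [ChartedSpace H X]

/-- A map into the fibre product is smooth as soon as its components are. -/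
theorem contMDiffWithinAt_iff {c : X → FP f g hf hg} {s : Set X} {x : X} :
    ContMDiffWithinAt I (𝓡 (FP f g hf hg).dim) ∞ c s x ↔
      ContMDiffWithinAt I (𝓡 M.dim) ∞ (fun y => (fst (c y))) s x ∧
      ContMDiffWithinAt I (𝓡 N.dim) ∞ (fun y => (snd (c y))) s x := by
  constructor
  · intro h
    exact ⟨smooth_fst.contMDiffAt.comp_contMDiffWithinAt x h,
      smooth_snd.contMDiffAt.comp_contMDiffWithinAt x h⟩
  rintro ⟨h1, h2⟩
  let := FPSet.chartedSpace hf hg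
  have key : ∀ c : X → FPSet f g,
      ContMDiffWithinAt I (𝓡 M.dim) ∞ (fun y => (c y).fst) s x →
      ContMDiffWithinAt I (𝓡 N.dim) ∞ (fun y => (c y).snd) s x →
      ContMDiffWithinAt I (𝓡 (FPSet.fdim M N P)) ∞ c s x := by
    intro c h1 h2
    rw [contMDiffWithinAt_iff_target]
    refine ⟨FPSet.isEmbedding_toProd.isInducing.continuousWithinAt_iff.2
      (h1.continuousWithinAt.prodMk h2.continuousWithinAt), ?_⟩
    set p := (FPSet.exists_pre (g := g) hf (c x)).some with hp
    have hz : extChartAt (𝓡 (FPSet.fdim M N P)) (c x) =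
      (p.chart hg).toPartialEquiv := by
      rw [extChartAt, OpenPartialHomeomorph.extend]
      simp
      rfl
    have k1 := (contMDiffAt_of_mem_maximalAtlas p.hφ p.mφ).comp_contMDiffWithinAt x h1
    have k2 := (contMDiffAt_of_mem_maximalAtlas p.hη p.mη).comp_contMDiffWithinAt x h2
    have k3 := (contDiff_snd.comp p.e.contDiff).contMDiff.contMDiffAt.comp_contMDiffWithinAt x k1
    rw [hz]
    exact p.L.symm.contDiff.contMDiff.contMDiffAt.comp_contMDiffWithinAt x (k3.prodMk_space k2)
  exact key c h1 h2

theorem contMDiffOn_iff {c : X → FP f g hf hg} {s : Set X} :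
    ContMDiffOn I (𝓡 (FP f g hf hg).dim) ∞ c s ↔
      ContMDiffOn I (𝓡 M.dim) ∞ (fun y => (fst (c y))) s ∧
      ContMDiffOn I (𝓡 N.dim) ∞ (fun y => (snd (c y))) s := by
  simp only [ContMDiffOn, contMDiffWithinAt_iff]
  exact ⟨fun h => ⟨fun x hx => (h x hx).1, fun x hx => (h x hx).2⟩,
    fun h x hx => ⟨h.1 x hx, h.2 x hx⟩⟩

theorem contMDiffAt_iff {c : X → FP f g hf hg} {x : X} :
    ContMDiffAt I (𝓡 (FP f g hf hg).dim) ∞ c x ↔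
      ContMDiffAt I (𝓡 M.dim) ∞ (fun y => (fst (c y))) x ∧
      ContMDiffAt I (𝓡 N.dim) ∞ (fun y => (snd (c y))) x := contMDiffWithinAt_iff

theorem contMDiff_iff {c : X → FP f g hf hg} :
    ContMDiff I (𝓡 (FP f g hf hg).dim) ∞ c ↔
      ContMDiff I (𝓡 M.dim) ∞ (fun y => (fst (c y))) ∧
      ContMDiff I (𝓡 N.dim) ∞ (fun y => (snd (c y))) := by
  simp only [ContMDiff, contMDiffAt_iff, forall_and]

end lift

open Classical in
/-- Gluing of components that are compatible near a point. -/
theorem exists_lift {X : Mfd.{u}} {a : X → M} {b : X → N} {x : X} (ha : SmoothAt a x)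
    (hb : SmoothAt b x) (h : ∀ᶠ y in 𝓝 x, f (a y) = g (b y)) :
    ∃ c : X → FP f g hf hg, SmoothAt c x ∧ (fst (c x)) = a x ∧ (snd (c x)) = b x ∧
      ∀ᶠ y in 𝓝 x, (fst (c y)) = a y ∧ (snd (c y)) = b y := by
  have h0 := h.self_of_nhds
  set c : X → FP f g hf hg := fun y =>
    if h' : f (a y) = g (b y) then mk (a y) (b y) h' else mk (a x) (b x) h0 with hc
  have hE : ∀ᶠ y in 𝓝 x, (fst (c y)) = a y ∧ (snd (c y)) = b y := by
    filter_upwards [h] with y hy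
    simp [hc, hy]
  exact ⟨c, contMDiffAt_iff.2 ⟨ha.congr_of_eventuallyEq (hE.mono fun _ h => h.1),
    hb.congr_of_eventuallyEq (hE.mono fun _ h => h.2)⟩, hE.self_of_nhds.1, hE.self_of_nhds.2, hE⟩

end FP

/-- Through every point of the source there passes a smooth local section of `f`. -/
def HasSec {M N : Mfd.{u}} (f : M → N) : Prop :=
  ∀ x, ∃ σ : N → M, SmoothAt σ (f x) ∧ σ (f x) = x ∧ ∀ᶠ y in 𝓝 (f x), f (σ y) = y

namespace Mfd

theorem Subm.smooth {M N : Mfd.{u}} {f : M → N} (hf : Subm f) : Smooth f :=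
  Manifold.IsSubmersion.contMDiff hf

theorem Subm.hasSec {M N : Mfd.{u}} {f : M → N} (hf : Subm f) : HasSec f := by
  intro x
  obtain ⟨F, i1, i2, h⟩ := hf
  have h := h x
  set φ := h.domChart
  set ψ := h.codChart
  set e := h.equiv
  have he : ∀ w ∈ φ.target, ψ (f (φ.symm w)) = (e w).1 := by
    intro w hw
    have hw' : w ∈ (h.domChart.extend (𝓡 M.dim)).target := by simpa using hw
    have := h.writtenInCharts hw'
    simpa using this
  have hx : x ∈ φ.source := h.mem_domChart_source
  have hfx : f x ∈ ψ.source := h.mem_codChart_source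
  have hs : φ.source ⊆ f ⁻¹' ψ.source := h.source_subset_preimage_source
  set k : N → EuclideanSpace ℝ (Fin M.dim) := fun y => e.symm (ψ y, (e (φ x)).2) with hk
  have hk0 : k (f x) = φ x := by
    have := he _ (φ.map_source hx)
    rw [φ.left_inv hx] at this
    simp [hk, this]
  have hks : ContMDiffAt (𝓡 N.dim) (𝓡 M.dim) ∞ k (f x) :=
    e.symm.contDiff.contMDiff.contMDiffAt.comp _
      ((contMDiffAt_of_mem_maximalAtlas h.codChart_mem_maximalAtlas hfx).prodMk_space
        contMDiffAt_const)
  have hmem : ∀ᶠ y in 𝓝 (f x), k y ∈ φ.target :=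
    hks.continuousAt.eventually_mem (by
      rw [hk0]; exact φ.open_target.mem_nhds (φ.map_source hx))
  refine ⟨fun y => φ.symm (k y), ?_, ?_, ?_⟩
  · refine ContMDiffAt.comp (f x) ?_ hks
    rw [hk0]
    exact contMDiffAt_symm_of_mem_maximalAtlas h.domChart_mem_maximalAtlas (φ.map_source hx)
  · simp only [hk0, φ.left_inv hx]
  · filter_upwards [hmem, ψ.open_source.mem_nhds hfx] with y hy hy'
    refine ψ.injOn (hs (φ.map_target hy)) hy' ?_
    rw [he _ hy]
    simp [hk]

/-- A map `H` of a normed space with derivative the identity at `a` restricts to a smooth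
chart on a neighbourhood of `a` contained in a given neighbourhood on which it is smooth. -/
theorem exists_localDiffeo {E : Type*} [NormedAddCommGroup E] [NormedSpace ℝ E]
    [CompleteSpace E] {H : E → E} {a : E} {U : Set E} (hU : IsOpen U) (ha : a ∈ U)
    (hH : ContDiffOn ℝ ∞ H U) (hd : HasFDerivAt H (ContinuousLinearEquiv.refl ℝ E : E →L[ℝ] E) a) :
    ∃ θ : OpenPartialHomeomorph E E, a ∈ θ.source ∧ θ.source ⊆ U ∧ (∀ x, θ x = H x) ∧
      ContDiffOn ℝ ∞ θ θ.source ∧ ContDiffOn ℝ ∞ θ.symm θ.target := by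
  have hHa : ∀ x ∈ U, ContDiffAt ℝ ∞ H x := fun x hx => hH.contDiffAt (hU.mem_nhds hx)
  set θ0 := (hHa a ha).toOpenPartialHomeomorph H hd (by simp) with hθ0
  have hc : ContinuousOn (fderiv ℝ H) U := hH.continuousOn_fderiv_of_isOpen hU (by simp)
  have hdf : fderiv ℝ H a = (ContinuousLinearEquiv.refl ℝ E : E →L[ℝ] E) := hd.fderiv
  set V := U ∩ fderiv ℝ H ⁻¹' (interior (range ((↑) : (E ≃L[ℝ] E) → E →L[ℝ] E))) with hV
  have hVo : IsOpen V := hc.isOpen_inter_preimage hU isOpen_interior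
  have haV : a ∈ V := by
    refine ⟨ha, ?_⟩
    rw [mem_preimage, hdf, mem_interior_iff_mem_nhds]
    exact ContinuousLinearEquiv.nhds _
  have hsrc : (θ0.restr V).source = θ0.source ∩ V := by
    rw [θ0.restr_source, hVo.interior_eq]
  refine ⟨θ0.restr V, ?_, ?_, fun x => rfl, ?_, ?_⟩
  · rw [hsrc]
    exact ⟨(hHa a ha).mem_toOpenPartialHomeomorph_source hd (by simp), haV⟩
  · rw [hsrc]; exact fun x hx => hx.2.1
  · rw [hsrc]; exact hH.mono fun x hx => hx.2.1
  · intro y hy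
    have hx := (θ0.restr V).map_target hy
    rw [hsrc] at hx
    obtain ⟨L, hL⟩ := interior_subset hx.2.2
    have hx1 := hHa _ hx.2.1
    have hx2 : HasFDerivAt H (L : E →L[ℝ] E) ((θ0.restr V).symm y) := by
      rw [hL]; exact (hx1.differentiableAt (by simp)).hasFDerivAt
    exact ((θ0.restr V).contDiffAt_symm hy hx2 hx1).contDiffWithinAt

theorem subm_of_hasSec {M N : Mfd.{u}} {f : M → N} (hs : Smooth f) (hf : HasSec f) : Subm f := by
  refine ⟨EuclideanSpace ℝ (Fin (M.dim - N.dim)), inferInstance, inferInstance, fun x => ?_⟩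
  obtain ⟨σ, hσ, hσx, hfσ⟩ := hf x
  set E := EuclideanSpace ℝ (Fin M.dim)
  set E' := EuclideanSpace ℝ (Fin N.dim)
  set φ := chartAt E x with hφ
  set ψ := chartAt E' (f x) with hψ
  have mφ : φ ∈ IsManifold.maximalAtlas (𝓡 M.dim) ∞ M := IsManifold.chart_mem_maximalAtlas x
  have mψ : ψ ∈ IsManifold.maximalAtlas (𝓡 N.dim) ∞ N := IsManifold.chart_mem_maximalAtlas (f x)
  have hx : x ∈ φ.source := mem_chart_source _ _
  have hfx : f x ∈ ψ.source := mem_chart_source _ _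
  set a := φ x with ha
  set b := ψ (f x) with hb
  -- `f` in the charts, on an open set
  set U := φ.target ∩ (f ∘ φ.symm) ⁻¹' ψ.source with hU
  have hfφ : ContMDiffOn (𝓡 M.dim) (𝓡 N.dim) ∞ (f ∘ φ.symm) φ.target :=
    hs.comp_contMDiffOn (contMDiffOn_symm_of_mem_maximalAtlas mφ)
  have hUo : IsOpen U := hfφ.continuousOn.isOpen_inter_preimage φ.open_target ψ.open_source
  have haU : a ∈ U := ⟨φ.map_source hx, by simpa [ha, φ.left_inv hx] using hfx⟩
  set g : E → E' := fun w => ψ (f (φ.symm w)) with hg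
  have hgU : ContDiffOn ℝ ∞ g U := contMDiffOn_iff_contDiffOn.1
    ((contMDiffOn_of_mem_maximalAtlas mψ).comp (hfφ.mono fun w hw => hw.1) fun w hw => hw.2)
  have hga : ContDiffAt ℝ ∞ g a := hgU.contDiffAt (hUo.mem_nhds haU)
  set A := fderiv ℝ g a with hA
  have hgA : HasFDerivAt g A a := (hga.differentiableAt (by simp)).hasFDerivAt
  -- the derivative is surjective
  have hAs : Function.Surjective A := by
    set s : E' → E := fun v => φ (σ (ψ.symm v)) with hs'
    have hψb : ψ.symm b = f x := ψ.left_inv hfx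
    have hsb : s b = a := by simp [hs', hψb, hσx, ha]
    have h1 : ContMDiffAt (𝓡 N.dim) (𝓡 N.dim) ∞ ψ.symm b :=
      contMDiffAt_symm_of_mem_maximalAtlas mψ (ψ.map_source hfx)
    have h2 : ContMDiffAt (𝓡 N.dim) (𝓡 M.dim) ∞ (fun v => σ (ψ.symm v)) b :=
      ContMDiffAt.comp b (by rw [hψb]; exact hσ) h1
    have h3 : ContDiffAt ℝ ∞ s b := contMDiffAt_iff_contDiffAt.1 <|
      ContMDiffAt.comp b (contMDiffAt_of_mem_maximalAtlas mφ (by simpa [hψb, hσx] using hx)) h2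
    have h4 : ∀ᶠ v in 𝓝 b, g (s v) = v := by
      have e1 : ∀ᶠ v in 𝓝 b, v ∈ ψ.target := ψ.open_target.mem_nhds (ψ.map_source hfx)
      have e2 : ∀ᶠ v in 𝓝 b, f (σ (ψ.symm v)) = ψ.symm v := by
        have := h1.continuousAt
        rw [ContinuousAt, hψb] at this
        exact this.eventually hfσ
      have e3 : ∀ᶠ v in 𝓝 b, σ (ψ.symm v) ∈ φ.source :=
        h2.continuousAt.eventually_mem (by
          simp only [hψb, hσx]; exact φ.open_source.mem_nhds hx)
      filter_upwards [e1, e2, e3] with v v1 v2 v3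
      simp [hg, hs', φ.left_inv v3, v2, ψ.right_inv v1]
    have h5 : HasFDerivAt s (fderiv ℝ s b) b := (h3.differentiableAt (by simp)).hasFDerivAt
    have h6 : HasFDerivAt (fun v => g (s v)) (A.comp (fderiv ℝ s b)) b :=
      HasFDerivAt.comp (g := g) (f := s) b (by rw [hsb]; exact hgA) h5
    have h7 : HasFDerivAt (fun v => g (s v)) (ContinuousLinearMap.id ℝ E') b :=
      (hasFDerivAt_id b).congr_of_eventuallyEq h4
    intro v
    exact ⟨fderiv ℝ s b v, by
      simpa using congrArg (fun T : E' →L[ℝ] E' => T v) (h6.unique h7)⟩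
  -- a linear splitting
  obtain ⟨e, he⟩ : ∃ e : E ≃L[ℝ] (E' × EuclideanSpace ℝ (Fin (M.dim - N.dim))),
      ∀ v, (e v).1 = A v := by
    have hr := A.toLinearMap.finrank_range_add_finrank_ker
    have hrt : A.toLinearMap.range = ⊤ := LinearMap.range_eq_top.2 hAs
    rw [hrt, finrank_top, finrank_euclideanSpace_fin, finrank_euclideanSpace_fin] at hr
    obtain ⟨Q, hQ⟩ := A.toLinearMap.ker.exists_isCompl
    have hk : Module.finrank ℝ A.toLinearMap.ker =
        Module.finrank ℝ (EuclideanSpace ℝ (Fin (M.dim - N.dim))) := by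
      rw [finrank_euclideanSpace_fin]; omega
    let pr := Submodule.projectionOnto _ _ hQ
    let e1 : E ≃ₗ[ℝ] E' × A.toLinearMap.ker :=
      LinearMap.equivProdOfSurjectiveOfIsCompl A.toLinearMap pr hrt
        (Submodule.range_projectionOnto _) (by rw [Submodule.ker_projectionOnto]; exact hQ)
    let e2 := e1.trans (LinearEquiv.prodCongr (LinearEquiv.refl ℝ E')
      (LinearEquiv.ofFinrankEq _ _ hk))
    exact ⟨e2.toContinuousLinearEquiv, fun v => rfl⟩
  -- the straightening map
  set H : E → E := fun u => e.symm (g u, (e u).2) with hH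
  have hHU : ContDiffOn ℝ ∞ H U := e.symm.contDiff.comp_contDiffOn
    (hgU.prodMk (contDiff_snd.comp e.contDiff).contDiffOn)
  have hHd : HasFDerivAt H (ContinuousLinearEquiv.refl ℝ E : E →L[ℝ] E) a := by
    have h0 : HasFDerivAt (fun u => (e u).2) ((ContinuousLinearMap.snd ℝ E'
        (EuclideanSpace ℝ (Fin (M.dim - N.dim)))).comp e.toContinuousLinearMap) a :=
      ((ContinuousLinearMap.snd ℝ E'
        (EuclideanSpace ℝ (Fin (M.dim - N.dim)))).comp e.toContinuousLinearMap).hasFDerivAt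
    have h1 := hgA.prodMk h0
    have h2 := e.symm.toContinuousLinearMap.hasFDerivAt.comp a h1
    refine h2.congr_fderiv ?_
    ext1 v
    change e.symm (A v, (e v).2) = v
    rw [← he]
    simp
  obtain ⟨θ, hθa, hθU, hθH, hθ1, hθ2⟩ := exists_localDiffeo hUo haU hHU hHd
  have hc1 : ContMDiffOn (𝓡 M.dim) (𝓡 M.dim) ∞ θ θ.source := contMDiffOn_iff_contDiffOn.2 hθ1
  have hc2 : ContMDiffOn (𝓡 M.dim) (𝓡 M.dim) ∞ θ.symm θ.target := contMDiffOn_iff_contDiffOn.2 hθ2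
  have hmem : φ ≫ₕ θ ∈ IsManifold.maximalAtlas (𝓡 M.dim) ∞ M := by
    apply OpenPartialHomeomorph.mem_maximalAtlas_of_contMDiffOn
    · exact hc1.comp ((contMDiffOn_of_mem_maximalAtlas mφ).mono fun y hy => hy.1) fun y hy => hy.2
    · exact (contMDiffOn_symm_of_mem_maximalAtlas mφ).comp (hc2.mono fun y hy => hy.1)
        fun y hy => hy.2
  refine Manifold.IsSubmersionAtOfComplement.mk_of_continuousAt hs.continuous.continuousAt e
    (φ ≫ₕ θ) ψ ⟨hx, hθa⟩ hfx hmem mψ ?_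
  intro w hw
  have hw' : w ∈ (φ ≫ₕ θ).target := by simpa using hw
  have h1 : θ (θ.symm w) = w := θ.right_inv hw'.1
  rw [hθH] at h1
  have h2 := congrArg (fun v => (e v).1) h1
  simp only [hH, ContinuousLinearEquiv.apply_symm_apply] at h2
  simpa [hg] using h2

theorem subm_iff_hasSec {M N : Mfd.{u}} {f : M → N} : Subm f ↔ Smooth f ∧ HasSec f :=
  ⟨fun h => ⟨h.smooth, h.hasSec⟩, fun h => subm_of_hasSec h.1 h.2⟩

end Mfd

namespace Mfd

theorem Subm.comp {M N P : Mfd.{u}} {f : M → N} {g : N → P} (hg : Subm g) (hf : Subm f) :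
    Subm fun x => g (f x) := by
  refine subm_of_hasSec (hg.smooth.comp hf.smooth) fun x => ?_
  obtain ⟨σ, h1, h2, h3⟩ := hf.hasSec x
  obtain ⟨τ, k1, k2, k3⟩ := hg.hasSec (f x)
  refine ⟨fun y => σ (τ y), ContMDiffAt.comp _ (by rw [k2]; exact h1) k1, by simp only [k2, h2], ?_⟩
  have := k1.continuousAt
  rw [ContinuousAt, k2] at this
  filter_upwards [this.eventually h3, k3] with y y1 y2
  simp only [y1, y2]

theorem SurjSubm.smooth {M N : Mfd.{u}} {f : M → N} (hf : SurjSubm f) : Smooth f := hf.subm.smooth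

theorem SurjSubm.comp {M N P : Mfd.{u}} {f : M → N} {g : N → P} (hg : SurjSubm g)
    (hf : SurjSubm f) : SurjSubm fun x => g (f x) :=
  ⟨hg.subm.comp hf.subm, hg.surj.comp hf.surj⟩

end Mfd

namespace FP

variable {M N P : Mfd.{u}} {f : M → P} {g : N → P}

theorem surjSubm_snd (hf : SurjSubm f) (hg : Smooth g) :
    SurjSubm (M := FP f g hf.subm hg) snd := by
  refine ⟨subm_of_hasSec smooth_snd fun z => ?_, fun y => ?_⟩
  · obtain ⟨σ, h1, h2, h3⟩ := hf.subm.hasSec (fst z)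
    rw [(w z)] at h1 h2 h3
    obtain ⟨c, c1, c2, c3, c4⟩ := exists_lift (hf := hf.subm) (hg := hg) (x := (snd z))
      (a := fun y => σ (g y)) (b := fun y => y) (ContMDiffAt.comp (snd z) h1 hg.contMDiffAt)
      contMDiffAt_id (hg.continuous.continuousAt.eventually h3)
    exact ⟨c, c1, FP.ext (c2.trans h2) c3, c4.mono fun y hy => hy.2⟩
  · obtain ⟨x, hx⟩ := hf.surj (g y)
    exact ⟨mk x y hx, rfl⟩

theorem surjSubm_fst (hf : Subm f) (hg : SurjSubm g) :
    SurjSubm (M := FP f g hf hg.smooth) fst := by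
  refine ⟨subm_of_hasSec smooth_fst fun z => ?_, fun y => ?_⟩
  · obtain ⟨σ, h1, h2, h3⟩ := hg.subm.hasSec (snd z)
    rw [← (w z)] at h1 h2 h3
    obtain ⟨c, c1, c2, c3, c4⟩ := exists_lift (hf := hf) (hg := hg.smooth) (x := (fst z))
      (a := fun y => y) (b := fun y => σ (f y)) contMDiffAt_id
      (ContMDiffAt.comp (fst z) h1 hf.smooth.contMDiffAt)
      ((hf.smooth.continuous.continuousAt.eventually h3).mono fun y hy => hy.symm)
    exact ⟨c, c1, FP.ext c2 (c3.trans h2), c4.mono fun y hy => hy.1⟩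
  · obtain ⟨x, hx⟩ := hg.surj (f y)
    exact ⟨mk y x hx.symm, rfl⟩

end FP

/-- A Lie groupoid with manifold of objects `M`. The product `mul x y` is defined when the target
of `x` is the source of `y`. -/
structure LieGroupoid (M : Mfd.{u}) where
  arr : Mfd.{u}
  s : arr → M
  t : arr → M
  one : M → arr
  inv : arr → arr
  mul : ∀ x y : arr, t x = s y → arr
  hs : SurjSubm s
  ht : SurjSubm t
  smooth_one : Smooth one
  smooth_inv : Smooth inv
  smooth_mul : Smooth fun z : FP t s ht.subm hs.subm.smooth => mul (FP.fst z) (FP.snd z) (FP.w z)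
  s_one : ∀ m, s (one m) = m
  t_one : ∀ m, t (one m) = m
  s_inv : ∀ x, s (inv x) = t x
  t_inv : ∀ x, t (inv x) = s x
  s_mul : ∀ x y h, s (mul x y h) = s x
  t_mul : ∀ x y h, t (mul x y h) = t y
  one_mul : ∀ x, mul (one (s x)) x (t_one _) = x
  mul_one : ∀ x, mul x (one (t x)) (s_one _).symm = x
  mul_inv : ∀ x, mul x (inv x) (s_inv x).symm = one (s x)
  inv_mul : ∀ x, mul (inv x) x (t_inv x) = one (t x)
  mul_assoc : ∀ x y z h h', mul (mul x y h) z ((t_mul x y h).trans h') =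
    mul x (mul y z h') (h.trans (s_mul y z h').symm)

namespace LieGroupoid

variable {M M' : Mfd.{u}}

/-- The conjugate `r k r⁻¹`. -/
noncomputable def conj (R : LieGroupoid M) (r k : R.arr) (h : R.t r = R.s k) (h' : R.t k = R.t r) : R.arr :=
  R.mul (R.mul r k h) (R.inv r) ((R.t_mul r k h).trans (h'.trans (R.s_inv r).symm))

/-- Morphisms of Lie groupoids over the identity of the manifold of objects. -/
structure IsMorphism (R S : LieGroupoid M) (φ : R.arr → S.arr) : Prop where
  smooth : Smooth φ
  s_map : ∀ x, S.s (φ x) = R.s x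
  t_map : ∀ x, S.t (φ x) = R.t x
  map_mul : ∀ x y h, φ (R.mul x y h) =
    S.mul (φ x) (φ y) ((t_map x).trans (h.trans (s_map y).symm))

/-- Isomorphisms of Lie groupoids over the identity of the manifold of objects. -/
structure Iso (R S : LieGroupoid M) where
  toFun : R.arr → S.arr
  invFun : S.arr → R.arr
  left_inv : ∀ x, invFun (toFun x) = x
  right_inv : ∀ x, toFun (invFun x) = x
  mor : IsMorphism R S toFun
  mor_inv : IsMorphism S R invFun

/-- The inverse isomorphism. -/
noncomputable def Iso.symm {R S : LieGroupoid M} (Θ : Iso R S) : Iso S R :=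
  ⟨Θ.invFun, Θ.toFun, Θ.right_inv, Θ.left_inv, Θ.mor_inv, Θ.mor⟩

theorem IsMorphism.comp {R S T : LieGroupoid M} {φ : R.arr → S.arr} {ψ : S.arr → T.arr}
    (hψ : IsMorphism S T ψ) (hφ : IsMorphism R S φ) : IsMorphism R T fun x => ψ (φ x) where
  smooth := hψ.smooth.comp hφ.smooth
  s_map x := (hψ.s_map _).trans (hφ.s_map x)
  t_map x := (hψ.t_map _).trans (hφ.t_map x)
  map_mul x y h := by rw [hφ.map_mul, hψ.map_mul]

/-- Composition of isomorphisms. -/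
noncomputable def Iso.trans {R S T : LieGroupoid M} (Θ : Iso R S) (Λ : Iso S T) : Iso R T where
  toFun x := Λ.toFun (Θ.toFun x)
  invFun x := Θ.invFun (Λ.invFun x)
  left_inv x := by rw [Λ.left_inv, Θ.left_inv]
  right_inv x := by rw [Θ.right_inv, Λ.right_inv]
  mor := Λ.mor.comp Θ.mor
  mor_inv := Θ.mor_inv.comp Λ.mor_inv

/-- The manifold of arrows `M' ×_M 𝒢 ×_M M'` of the pull-back groupoid along `p : M' → M`,
consisting of triples `(src, mid, tgt)` with `p src = s mid` and `t mid = p tgt`. -/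
noncomputable def PB (𝒢 : LieGroupoid M) (p : M' → M) (hp : SurjSubm p) : Mfd.{u} :=
  FP p (fun a : FP p 𝒢.s hp.subm 𝒢.hs.smooth => 𝒢.t (FP.snd a)) hp.subm
    (𝒢.ht.smooth.comp FP.smooth_snd)

/-- The set of triples `(x, γ, y)` with `p x = s γ` and `t γ = p y`. -/
abbrev PBSet {X A Y : Type u} (s t : A → Y) (p : X → Y) : Type u :=
  FPSet p (fun a : FPSet p s => t (FP.snd a))

namespace PB

section
variable {X A Y : Type u} {s t : A → Y} {p : X → Y}

/-- First component of an arrow of the pull-back groupoid. -/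
def src (z : PBSet s t p) : X := FP.fst (FP.snd z)
/-- Middle component of an arrow of the pull-back groupoid. -/
def mid (z : PBSet s t p) : A := FP.snd (FP.snd z)
/-- Last component of an arrow of the pull-back groupoid. -/
def tgt (z : PBSet s t p) : X := FP.fst z

theorem ws (z : PBSet s t p) : p (PB.src z) = s (PB.mid z) := FP.w (FP.snd z)
theorem wt (z : PBSet s t p) : t (PB.mid z) = p (PB.tgt z) := (FP.w z).symm

/-- The arrow `(x, γ, y)` of the pull-back groupoid. -/
def mk (x : X) (γ : A) (y : X) (h : p x = s γ) (h' : t γ = p y) : PBSet s t p :=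
  FP.mk y (FP.mk x γ h) h'.symm

theorem ext {z z' : PBSet s t p} (h1 : PB.src z = PB.src z') (h2 : PB.mid z = PB.mid z')
    (h3 : PB.tgt z = PB.tgt z') : z = z' :=
  FP.ext h3 (FP.ext h1 h2)
end

variable {𝒢 : LieGroupoid M} {p : M' → M} (hp : SurjSubm p)

theorem smooth_src : Smooth (M := PB 𝒢 p hp) src := FP.smooth_fst.comp FP.smooth_snd
theorem smooth_mid : Smooth (M := PB 𝒢 p hp) mid := FP.smooth_snd.comp FP.smooth_snd
theorem smooth_tgt : Smooth (M := PB 𝒢 p hp) tgt := FP.smooth_fst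

theorem contMDiffOn {E H X : Type*} [NormedAddCommGroup E] [NormedSpace ℝ E]
    [TopologicalSpace H] {I : ModelWithCorners ℝ E H} [TopologicalSpace X] [ChartedSpace H X]
    {c : X → PB 𝒢 p hp} {s : Set X}
    (h1 : ContMDiffOn I (𝓡 M'.dim) ∞ (fun x => (PB.src (c x))) s)
    (h2 : ContMDiffOn I (𝓡 𝒢.arr.dim) ∞ (fun x => (PB.mid (c x))) s)
    (h3 : ContMDiffOn I (𝓡 M'.dim) ∞ (fun x => (PB.tgt (c x))) s) :
    ContMDiffOn I (𝓡 (PB 𝒢 p hp).dim) ∞ c s :=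
  FP.contMDiffOn_iff.2 ⟨h3, FP.contMDiffOn_iff.2 ⟨h1, h2⟩⟩

theorem contMDiff {E H X : Type*} [NormedAddCommGroup E] [NormedSpace ℝ E]
    [TopologicalSpace H] {I : ModelWithCorners ℝ E H} [TopologicalSpace X] [ChartedSpace H X]
    {c : X → PB 𝒢 p hp}
    (h1 : ContMDiff I (𝓡 M'.dim) ∞ fun x => (PB.src (c x)))
    (h2 : ContMDiff I (𝓡 𝒢.arr.dim) ∞ fun x => (PB.mid (c x)))
    (h3 : ContMDiff I (𝓡 M'.dim) ∞ fun x => (PB.tgt (c x))) :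
    ContMDiff I (𝓡 (PB 𝒢 p hp).dim) ∞ c :=
  FP.contMDiff_iff.2 ⟨h3, FP.contMDiff_iff.2 ⟨h1, h2⟩⟩

theorem surjSubm_tgt : SurjSubm (M := PB 𝒢 p hp) tgt :=
  FP.surjSubm_fst hp.subm (𝒢.ht.comp (FP.surjSubm_snd hp 𝒢.hs.smooth))

theorem surjSubm_src : SurjSubm (M := PB 𝒢 p hp) src :=
  (FP.surjSubm_fst hp.subm 𝒢.hs).comp
    (FP.surjSubm_snd hp (𝒢.ht.smooth.comp FP.smooth_snd))

theorem exists_lift {X : Mfd.{u}} {a b : X → M'} {γ : X → 𝒢.arr} {x : X} (ha : SmoothAt a x)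
    (hγ : SmoothAt γ x) (hb : SmoothAt b x) (h : ∀ᶠ y in 𝓝 x, p (a y) = 𝒢.s (γ y))
    (h' : ∀ᶠ y in 𝓝 x, 𝒢.t (γ y) = p (b y)) :
    ∃ c : X → PB 𝒢 p hp, SmoothAt c x ∧ (PB.src (c x)) = a x ∧ (PB.mid (c x)) = γ x ∧ (PB.tgt (c x)) = b x ∧
      ∀ᶠ y in 𝓝 x, (PB.src (c y)) = a y ∧ (PB.mid (c y)) = γ y ∧ (PB.tgt (c y)) = b y := by
  obtain ⟨c, c1, c2, c3, c4⟩ := FP.exists_lift (hf := hp.subm) (hg := 𝒢.hs.smooth) ha hγ h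
  have h'' : ∀ᶠ y in 𝓝 x, p (b y) = 𝒢.t (FP.snd (c y)) := by
    filter_upwards [h', c4] with y h1 h2
    rw [h2.2, h1]
  obtain ⟨d, d1, d2, d3, d4⟩ := FP.exists_lift (hf := hp.subm)
    (hg := 𝒢.ht.smooth.comp FP.smooth_snd) hb c1 h''
  refine ⟨d, d1, (congrArg FP.fst d3).trans c2, (congrArg FP.snd d3).trans c3, d2, ?_⟩
  filter_upwards [c4, d4] with y h1 h2
  exact ⟨(congrArg FP.fst h2.2).trans h1.1, (congrArg FP.snd h2.2).trans h1.2, h2.1⟩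

end PB

/-- The pull-back of a Lie groupoid along a surjective submersion. -/
noncomputable def pullback (𝒢 : LieGroupoid M) (p : M' → M) (hp : SurjSubm p) :
    LieGroupoid M' where
  arr := PB 𝒢 p hp
  s := PB.src
  t := PB.tgt
  one x := PB.mk x (𝒢.one (p x)) x (𝒢.s_one _).symm (𝒢.t_one _)
  inv z := PB.mk (PB.tgt z) (𝒢.inv (PB.mid z)) (PB.src z) ((PB.wt z).symm.trans (𝒢.s_inv _).symm)
    ((𝒢.t_inv _).trans (PB.ws z).symm)
  mul z z' h := PB.mk (PB.src z) (𝒢.mul (PB.mid z) (PB.mid z') ((PB.wt z).trans ((congrArg p h).trans (PB.ws z')))) (PB.tgt z')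
    ((PB.ws z).trans (𝒢.s_mul _ _ _).symm) ((𝒢.t_mul _ _ _).trans (PB.wt z'))
  hs := (PB.surjSubm_src hp)
  ht := (PB.surjSubm_tgt hp)
  smooth_one := (PB.contMDiff hp) contMDiff_id (𝒢.smooth_one.comp hp.smooth) contMDiff_id
  smooth_inv := (PB.contMDiff hp) (PB.smooth_tgt hp) (𝒢.smooth_inv.comp (PB.smooth_mid hp)) (PB.smooth_src hp)
  smooth_mul := by
    have k1 := PB.surjSubm_tgt (𝒢 := 𝒢) hp
    have k2 := PB.surjSubm_src (𝒢 := 𝒢) hp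
    have l1 := FP.smooth_fst (hf := k1.subm) (hg := k2.smooth)
    have l2 := FP.smooth_snd (hf := k1.subm) (hg := k2.smooth)
    have h1 := (PB.smooth_src (𝒢 := 𝒢) hp).comp l1
    have h2 := (PB.smooth_mid (𝒢 := 𝒢) hp).comp l1
    have h3 := (PB.smooth_mid (𝒢 := 𝒢) hp).comp l2
    have h4 := (PB.smooth_tgt (𝒢 := 𝒢) hp).comp l2
    refine PB.contMDiff hp h1 ?_ h4
    exact 𝒢.smooth_mul.comp (FP.contMDiff_iff.2 ⟨h2, h3⟩ :
      Smooth (M := FP (M := PB 𝒢 p hp) (N := PB 𝒢 p hp) PB.tgt PB.src k1.subm k2.smooth)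
      (N := FP 𝒢.t 𝒢.s 𝒢.ht.subm 𝒢.hs.smooth)
      fun z => FP.mk (PB.mid (FP.fst z)) (PB.mid (FP.snd z))
      ((PB.wt (FP.fst z)).trans ((congrArg p (FP.w z)).trans (PB.ws (FP.snd z)))))
  s_one _ := rfl
  t_one _ := rfl
  s_inv _ := rfl
  t_inv _ := rfl
  s_mul _ _ _ := rfl
  t_mul _ _ _ := rfl
  one_mul z := by
    refine PB.ext rfl ?_ rfl
    have := 𝒢.one_mul (PB.mid z)
    simp only [← (PB.ws z)] at this
    exact this
  mul_one z := by
    refine PB.ext rfl ?_ rfl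
    have := 𝒢.mul_one (PB.mid z)
    simp only [(PB.wt z)] at this
    exact this
  mul_inv z := by
    refine PB.ext rfl ?_ rfl
    exact (𝒢.mul_inv (PB.mid z)).trans (congrArg 𝒢.one (PB.ws z).symm)
  inv_mul z := by
    refine PB.ext rfl ?_ rfl
    exact (𝒢.inv_mul (PB.mid z)).trans (congrArg 𝒢.one (PB.wt z))
  mul_assoc x y z h h' := PB.ext rfl (𝒢.mul_assoc _ _ _ _ _) rfl

/-- The pull-back of a morphism of Lie groupoids. -/
noncomputable def pullbackMap {R S : LieGroupoid M} {φ : R.arr → S.arr} (hφ : IsMorphism R S φ)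
    (p : M' → M) (hp : SurjSubm p) (z : (R.pullback p hp).arr) : (S.pullback p hp).arr :=
  PB.mk (PB.src z) (φ (PB.mid z)) (PB.tgt z) ((PB.ws z).trans (hφ.s_map _).symm)
    ((hφ.t_map _).trans (PB.wt z))

theorem isMorphism_pullbackMap {R S : LieGroupoid M} {φ : R.arr → S.arr}
    (hφ : IsMorphism R S φ) (p : M' → M) (hp : SurjSubm p) :
    IsMorphism (R.pullback p hp) (S.pullback p hp) (pullbackMap hφ p hp) where
  smooth := (PB.contMDiff hp) (PB.smooth_src hp) (hφ.smooth.comp (PB.smooth_mid hp)) (PB.smooth_tgt hp)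
  s_map _ := rfl
  t_map _ := rfl
  map_mul _ _ _ := PB.ext rfl (hφ.map_mul _ _ _) rfl

/-- The pull-back of an isomorphism of Lie groupoids. -/
noncomputable def Iso.pullback {R S : LieGroupoid M} (Θ : Iso R S) (p : M' → M)
    (hp : SurjSubm p) : Iso (R.pullback p hp) (S.pullback p hp) where
  toFun := pullbackMap Θ.mor p hp
  invFun := pullbackMap Θ.mor_inv p hp
  left_inv _ := PB.ext rfl (Θ.left_inv _) rfl
  right_inv _ := PB.ext rfl (Θ.right_inv _) rfl
  mor := isMorphism_pullbackMap _ p hp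
  mor_inv := isMorphism_pullbackMap _ p hp

/-- The canonical isomorphism `𝒢[q][p] ≅ 𝒢[q ∘ p]`, `(x, (p x, γ, p y), y) ↦ (x, γ, y)`. -/
noncomputable def pullbackComp {B₀ : Mfd.{u}} (B : LieGroupoid B₀) (q : M → B₀) (hq : SurjSubm q)
    (p : M' → M) (hp : SurjSubm p) :
    Iso ((B.pullback q hq).pullback p hp) (B.pullback (fun x => q (p x)) (hq.comp hp)) where
  toFun z := PB.mk (PB.src z) (PB.mid (PB.mid z)) (PB.tgt z)
    ((congrArg q (PB.ws z)).trans (PB.ws (PB.mid z)))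
    ((PB.wt (PB.mid z)).trans (congrArg q (PB.wt z)))
  invFun z := PB.mk (PB.src z)
    (PB.mk (p (PB.src z)) (PB.mid z) (p (PB.tgt z)) (PB.ws z) (PB.wt z)) (PB.tgt z) rfl rfl
  left_inv z := PB.ext rfl (PB.ext (PB.ws z) rfl (PB.wt z).symm) rfl
  right_inv _ := rfl
  mor :=
    { smooth := PB.contMDiff (hq.comp hp) (PB.smooth_src hp)
        ((PB.smooth_mid hq).comp (PB.smooth_mid hp)) (PB.smooth_tgt hp)
      s_map := fun _ => rfl
      t_map := fun _ => rfl
      map_mul := fun _ _ _ => rfl }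
  mor_inv :=
    { smooth := PB.contMDiff hp (PB.smooth_src (hq.comp hp))
        (PB.contMDiff hq (hp.smooth.comp (PB.smooth_src (hq.comp hp)))
        (PB.smooth_mid (hq.comp hp)) (hp.smooth.comp (PB.smooth_tgt (hq.comp hp))))
        (PB.smooth_tgt (hq.comp hp))
      s_map := fun _ => rfl
      t_map := fun _ => rfl
      map_mul := fun _ _ _ => rfl }

/-- The identity `B[q] ≅ B[q']` for equal maps `q` and `q'`. -/
noncomputable def pullbackCongr {B₀ : Mfd.{u}} (B : LieGroupoid B₀) {q q' : M → B₀}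
    (hq : SurjSubm q) (hq' : SurjSubm q') (h : ∀ x, q x = q' x) :
    Iso (B.pullback q hq) (B.pullback q' hq') where
  toFun z := PB.mk (PB.src z) (PB.mid z) (PB.tgt z) ((h _).symm.trans (PB.ws z))
    ((PB.wt z).trans (h _))
  invFun z := PB.mk (PB.src z) (PB.mid z) (PB.tgt z) ((h _).trans (PB.ws z))
    ((PB.wt z).trans (h _).symm)
  left_inv _ := rfl
  right_inv _ := rfl
  mor :=
    { smooth := PB.contMDiff hq' (PB.smooth_src hq) (PB.smooth_mid hq) (PB.smooth_tgt hq)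
      s_map := fun _ => rfl
      t_map := fun _ => rfl
      map_mul := fun _ _ _ => rfl }
  mor_inv :=
    { smooth := PB.contMDiff hq (PB.smooth_src hq') (PB.smooth_mid hq') (PB.smooth_tgt hq')
      s_map := fun _ => rfl
      t_map := fun _ => rfl
      map_mul := fun _ _ _ => rfl }

end LieGroupoid

/-- A finite dimensional Lie group. -/
structure LieGrp : Type (u + 1) where
  toMfd : Mfd.{u}
  [group : Group toMfd]
  [lieGroup : LieGroup (𝓡 toMfd.dim) ∞ toMfd]

instance : CoeSort LieGrp.{u} (Type u) := ⟨fun G => G.toMfd.carrier⟩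

attribute [instance] LieGrp.group LieGrp.lieGroup

/-- A crossed module of Lie groups `G → H`. The action of `H` on `G` by automorphisms is smooth
as a map `H × G → G`. -/
structure CrossedModule : Type (u + 1) where
  G : LieGrp.{u}
  H : LieGrp.{u}
  ρ : G →* H
  smooth_ρ : Smooth (M := G.toMfd) (N := H.toMfd) ρ
  act : H →* MulAut G
  smooth_act : ContMDiff ((𝓡 H.toMfd.dim).prod (𝓡 G.toMfd.dim)) (𝓡 G.toMfd.dim) ∞
    fun x : H × G => act x.1 x.2
  ρ_act : ∀ h g, ρ (act h g) = h * ρ g * h⁻¹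
  act_ρ : ∀ g g', act (ρ g) g' = g * g' * g⁻¹

namespace LieGroupoid

variable {M M' : Mfd.{u}}

theorem IsMorphism.map_one {R S : LieGroupoid M} {φ : R.arr → S.arr} (hφ : IsMorphism R S φ)
    (m : M) : φ (R.one m) = S.one m := by
  have hs : S.s (φ (R.one m)) = m := (hφ.s_map _).trans (R.s_one m)
  have ht : S.t (φ (R.one m)) = m := (hφ.t_map _).trans (R.t_one m)
  set e := φ (R.one m) with he
  have h1 : S.mul e e (ht.trans hs.symm) = e := by
    have := hφ.map_mul (R.one m) (R.one m) ((R.t_one m).trans (R.s_one m).symm)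
    rw [← this]
    have h2 := R.mul_one (R.one m)
    simp only [R.t_one] at h2
    rw [h2]
  have h3 := S.mul_assoc e e (S.inv e) (ht.trans hs.symm) (S.s_inv e).symm
  have h4 : S.mul e (S.one (S.s e)) (by rw [S.s_one, ht, hs]) = e := by
    have := S.mul_one e
    simp only [ht] at this
    simp only [hs]
    exact this
  simp only [h1, S.mul_inv, h4] at h3
  rw [← h3, hs]

/-- The arrows in the fibre `K_m` of the kernel of `φ : R → 𝒢`. -/
def ker {R 𝒢 : LieGroupoid M} (φ : R.arr → 𝒢.arr) (m : M) : Set R.arr := {r | φ r = 𝒢.one m}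

theorem IsMorphism.s_of_ker {R 𝒢 : LieGroupoid M} {φ : R.arr → 𝒢.arr} (hφ : IsMorphism R 𝒢 φ)
    {m : M} {r : R.arr} (hr : r ∈ ker φ m) : R.s r = m := by
  rw [← hφ.s_map, show φ r = 𝒢.one m from hr, 𝒢.s_one]

theorem IsMorphism.t_of_ker {R 𝒢 : LieGroupoid M} {φ : R.arr → 𝒢.arr} (hφ : IsMorphism R 𝒢 φ)
    {m : M} {r : R.arr} (hr : r ∈ ker φ m) : R.t r = m := by
  rw [← hφ.t_map, show φ r = 𝒢.one m from hr, 𝒢.t_one]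

/-- The map `b` is an isomorphism of abstract groups from `G` onto the fibre `K_m` of the kernel
of `φ`. -/
structure IsKerIso {R 𝒢 : LieGroupoid M} (φ : R.arr → 𝒢.arr) {G : LieGrp.{u}} (m : M)
    (b : G → R.arr) : Prop where
  mem : ∀ g, b g ∈ ker φ m
  mul : ∀ g g', ∃ h, b (g * g') = R.mul (b g) (b g') h
  inj : Function.Injective b
  surj : ∀ r ∈ ker φ m, ∃ g, b g = r

/-- A Lie groupoid `G`-extension of `𝒢`: a surjective submersive morphism `φ : R → 𝒢` over the
identity whose kernel is a locally trivial bundle of Lie groups with typical fibre `G`. Over an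
open set `U` the trivialisation is `(m, g) ↦ τ m g`, with inverse `k ↦ (s k, σ k)`. -/
structure GExtension (G : LieGrp.{u}) (𝒢 : LieGroupoid M) where
  R : LieGroupoid M
  φ : R.arr → 𝒢.arr
  mor : IsMorphism R 𝒢 φ
  surjSubm : SurjSubm φ
  locTriv : ∀ x : M, ∃ (U : Set M) (τ : M → G → R.arr) (σ : R.arr → G), IsOpen U ∧ x ∈ U ∧
    ContMDiffOn ((𝓡 M.dim).prod (𝓡 G.toMfd.dim)) (𝓡 R.arr.dim) ∞
      (fun z : M × G => τ z.1 z.2) (U ×ˢ univ) ∧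
    ContMDiffOn (𝓡 R.arr.dim) (𝓡 G.toMfd.dim) ∞ σ {r | ∃ m ∈ U, r ∈ ker φ m} ∧
    ∀ m ∈ U, IsKerIso φ m (τ m) ∧ ∀ g, σ (τ m g) = g

/-- The fibre over `m` of the band of a `G`-extension: the Lie group isomorphisms from `G` onto the
fibre `K_m` of the kernel. -/
structure Band {G : LieGrp.{u}} {𝒢 : LieGroupoid M} (E : GExtension G 𝒢) (m : M) where
  toFun : G → E.R.arr
  iso : IsKerIso E.φ m toFun
  smooth : Smooth (M := G.toMfd) toFun
  smooth_inv : ∃ σ : E.R.arr → G,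
    ContMDiffOn (𝓡 E.R.arr.dim) (𝓡 G.toMfd.dim) ∞ σ (ker E.φ m) ∧ ∀ g, σ (toFun g) = g

namespace Band
variable {G : LieGrp.{u}} {𝒢 : LieGroupoid M} {E : GExtension G 𝒢} {m : M} (b : Band E m)

theorem s_eq (g : G) : E.R.s (b.toFun g) = m := E.mor.s_of_ker (b.iso.mem g)
theorem t_eq (g : G) : E.R.t (b.toFun g) = m := E.mor.t_of_ker (b.iso.mem g)
end Band

/-- A principal `H`-bundle over the Lie groupoid `R ⇉ M`: a (right) principal `H`-bundle
`π : P → M` with a left action of `R` that commutes with the action of `H`. Over an open set `U`,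
a local trivialisation is `(m, h) ↦ (s m) · h`, with inverse `p ↦ (π p, δ p)`. -/
structure PrincipalBundle (H : LieGrp.{u}) (R : LieGroupoid M) where
  P : Mfd.{u}
  π : P → M
  hπ : SurjSubm π
  ract : P → H → P
  smooth_ract : ContMDiff ((𝓡 P.dim).prod (𝓡 H.toMfd.dim)) (𝓡 P.dim) ∞
    fun x : P × H => ract x.1 x.2
  π_ract : ∀ p h, π (ract p h) = π p
  ract_one : ∀ p, ract p 1 = p
  ract_mul : ∀ p h h', ract (ract p h) h' = ract p (h * h')
  locTriv : ∀ x : M, ∃ (U : Set M) (s : M → P) (δ : P → H), IsOpen U ∧ x ∈ U ∧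
    ContMDiffOn (𝓡 M.dim) (𝓡 P.dim) ∞ s U ∧
    ContMDiffOn (𝓡 P.dim) (𝓡 H.toMfd.dim) ∞ δ (π ⁻¹' U) ∧
    (∀ m ∈ U, π (s m) = m ∧ ∀ h, δ (ract (s m) h) = h) ∧
    ∀ p, π p ∈ U → ract (s (π p)) (δ p) = p
  lact : ∀ (r : R.arr) (p : P), R.t r = π p → P
  smooth_lact : Smooth fun z : FP R.t π R.ht.subm hπ.smooth =>
    lact (FP.fst z) (FP.snd z) (FP.w z)
  π_lact : ∀ r p h, π (lact r p h) = R.s r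
  one_lact : ∀ p, lact (R.one (π p)) p (R.t_one _) = p
  mul_lact : ∀ r r' p h h', lact (R.mul r r' h) p ((R.t_mul r r' h).trans h') =
    lact r (lact r' p h') (h.trans (π_lact r' p h').symm)
  lact_ract : ∀ r p h k, ract (lact r p h) k = lact r (ract p k) (h.trans (π_ract p k).symm)

/-- A `G → H`-extension of the Lie groupoid `𝒢`. The map `χ` from `P` to the band is smooth, in
the sense that `(p, g) ↦ χ p g` is smooth, and equivariant with respect to both actions. -/
structure Extension (C : CrossedModule.{u}) (𝒢 : LieGroupoid M) where
  ext : GExtension C.G 𝒢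
  bun : PrincipalBundle C.H ext.R
  χ : ∀ p : bun.P, Band ext (bun.π p)
  smooth_χ : ContMDiff ((𝓡 bun.P.dim).prod (𝓡 C.G.toMfd.dim)) (𝓡 ext.R.arr.dim) ∞
    fun x : bun.P × C.G => (χ x.1).toFun x.2
  χ_ract : ∀ p h g, (χ (bun.ract p h)).toFun g = (χ p).toFun (C.act h g)
  χ_lact : ∀ r p h g, (χ (bun.lact r p h)).toFun g = ext.R.conj r ((χ p).toFun g)
    (h.trans ((χ p).s_eq g).symm) (((χ p).t_eq g).trans h.symm)
  ract_ρ : ∀ p g, bun.ract p (C.ρ g) = bun.lact ((χ p).toFun g) p ((χ p).t_eq g)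

/-- Isomorphisms of `G → H`-extensions of `𝒢`: an isomorphism `Φ` of Lie groupoids over `𝒢` and a
diffeomorphism `Ψ` of the bundles, over the identity of `M`, equivariant and compatible with the
maps to the bands. -/
structure ExtIso {C : CrossedModule.{u}} {𝒢 : LieGroupoid M} (E E' : Extension C 𝒢) where
  Φ : Iso E.ext.R E'.ext.R
  φ_Φ : ∀ r, E'.ext.φ (Φ.toFun r) = E.ext.φ r
  Ψ : E.bun.P → E'.bun.P
  Ψinv : E'.bun.P → E.bun.P
  left_inv : ∀ p, Ψinv (Ψ p) = p
  right_inv : ∀ p, Ψ (Ψinv p) = p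
  smooth_Ψ : Smooth Ψ
  smooth_Ψinv : Smooth Ψinv
  π_Ψ : ∀ p, E'.bun.π (Ψ p) = E.bun.π p
  Ψ_ract : ∀ p h, Ψ (E.bun.ract p h) = E'.bun.ract (Ψ p) h
  Ψ_lact : ∀ r p h, Ψ (E.bun.lact r p h) =
    E'.bun.lact (Φ.toFun r) (Ψ p) ((Φ.mor.t_map r).trans (h.trans (π_Ψ p).symm))
  χ_Ψ : ∀ p g, (E'.χ (Ψ p)).toFun g = Φ.toFun ((E.χ p).toFun g)

section map

variable {𝒢 𝒢' : LieGroupoid M} (Θ : Iso 𝒢 𝒢')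

theorem Iso.surjSubm : SurjSubm Θ.toFun :=
  ⟨subm_of_hasSec Θ.mor.smooth fun x => ⟨Θ.invFun, Θ.mor_inv.smooth.contMDiffAt, Θ.left_inv x,
    Eventually.of_forall Θ.right_inv⟩, fun y => ⟨Θ.invFun y, Θ.right_inv y⟩⟩

theorem ker_map {R : LieGroupoid M} (φ : R.arr → 𝒢.arr) (m : M) :
    ker (fun r => Θ.toFun (φ r)) m = ker φ m := by
  ext r
  constructor
  · intro h
    have h' : Θ.toFun (φ r) = 𝒢'.one m := h
    change φ r = 𝒢.one m
    rw [← Θ.left_inv (φ r), h', Θ.mor_inv.map_one]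
  · intro h
    have h' : φ r = 𝒢.one m := h
    change Θ.toFun (φ r) = 𝒢'.one m
    rw [h', Θ.mor.map_one]

theorem IsKerIso.map {R : LieGroupoid M} {φ : R.arr → 𝒢.arr} {G : LieGrp.{u}} {m : M}
    {b : G → R.arr} (hb : IsKerIso φ m b) : IsKerIso (fun r => Θ.toFun (φ r)) m b where
  mem g := by rw [ker_map]; exact hb.mem g
  mul := hb.mul
  inj := hb.inj
  surj r hr := hb.surj r (by rwa [ker_map] at hr)

/-- The transport `(R, Θ ∘ φ)` of a `G`-extension `(R, φ)` along an isomorphism `Θ : 𝒢 ≅ 𝒢'`. -/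
noncomputable def GExtension.map {G : LieGrp.{u}} (E : GExtension G 𝒢) : GExtension G 𝒢' where
  R := E.R
  φ r := Θ.toFun (E.φ r)
  mor := Θ.mor.comp E.mor
  surjSubm := Θ.surjSubm.comp E.surjSubm
  locTriv x := by
    obtain ⟨U, τ, σ, h1, h2, h3, h4, h5⟩ := E.locTriv x
    refine ⟨U, τ, σ, h1, h2, h3, ?_, fun m hm => ⟨(h5 m hm).1.map Θ, (h5 m hm).2⟩⟩
    simpa only [ker_map] using h4

/-- The transport `(R, Θ ∘ φ, P, χ)` of a `G → H`-extension `(R, φ, P, χ)` along an isomorphism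
`Θ : 𝒢 ≅ 𝒢'`. -/
noncomputable def Extension.map {C : CrossedModule.{u}} (E : Extension C 𝒢) : Extension C 𝒢' where
  ext := E.ext.map Θ
  bun := E.bun
  χ p :=
    { toFun := (E.χ p).toFun
      iso := (E.χ p).iso.map Θ
      smooth := (E.χ p).smooth
      smooth_inv := by
        obtain ⟨σ, h1, h2⟩ := (E.χ p).smooth_inv
        refine ⟨σ, ?_, h2⟩
        change ContMDiffOn (𝓡 E.ext.R.arr.dim) (𝓡 C.G.toMfd.dim) ∞ σ
          (ker (fun r => Θ.toFun (E.ext.φ r)) _)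
        rw [ker_map]
        exact h1 }
  smooth_χ := E.smooth_χ
  χ_ract := E.χ_ract
  χ_lact := E.χ_lact
  ract_ρ := E.ract_ρ

end map

section pullback

variable {𝒢 : LieGroupoid M} (p : M' → M) (hp : SurjSubm p)

theorem surjSubm_pullbackMap {R : LieGroupoid M} {φ : R.arr → 𝒢.arr} (hφ : IsMorphism R 𝒢 φ)
    (h : SurjSubm φ) : SurjSubm (pullbackMap hφ p hp) := by
  refine ⟨subm_of_hasSec (isMorphism_pullbackMap hφ p hp).smooth fun z => ?_, fun y => ?_⟩
  · obtain ⟨σ, h1, h2, h3⟩ := h.subm.hasSec (PB.mid z)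
    set w : PB 𝒢 p hp := pullbackMap hφ p hp z with hw
    have hm := (PB.smooth_mid (𝒢 := 𝒢) hp).contMDiffAt (x := w)
    have h3' : ∀ᶠ y : PB 𝒢 p hp in 𝓝 w, φ (σ (PB.mid y)) = PB.mid y :=
      hm.continuousAt.eventually h3
    obtain ⟨c, c1, c2, c3, c4, c5⟩ := PB.exists_lift (𝒢 := R) hp (X := PB 𝒢 p hp)
      (a := PB.src) (b := PB.tgt) (γ := fun y => σ (PB.mid y)) (x := w)
      (PB.smooth_src (𝒢 := 𝒢) hp).contMDiffAt (ContMDiffAt.comp w h1 hm)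
      (PB.smooth_tgt (𝒢 := 𝒢) hp).contMDiffAt
      (h3'.mono fun y hy => by rw [← hφ.s_map, hy]; exact PB.ws y)
      (h3'.mono fun y hy => by rw [← hφ.t_map, hy]; exact PB.wt y)
    refine ⟨c, c1, PB.ext c2 (c3.trans h2) c4, ?_⟩
    filter_upwards [c5, h3'] with y hy hy'
    exact PB.ext hy.1 ((congrArg φ hy.2.1).trans hy') hy.2.2
  · obtain ⟨r, hr⟩ := h.surj (PB.mid y)
    exact ⟨PB.mk (PB.src y) r (PB.tgt y) ((PB.ws y).trans (by rw [← hr, hφ.s_map]))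
      ((by rw [← hr, hφ.t_map] : R.t r = 𝒢.t (PB.mid y)).trans (PB.wt y)), PB.ext rfl hr rfl⟩

theorem mem_ker_pullbackMap {R : LieGroupoid M} {φ : R.arr → 𝒢.arr} (hφ : IsMorphism R 𝒢 φ)
    (m : M') (z : (R.pullback p hp).arr) :
    z ∈ ker (R := R.pullback p hp) (𝒢 := 𝒢.pullback p hp) (pullbackMap hφ p hp) m ↔
      PB.src z = m ∧ PB.mid z ∈ ker φ (p m) ∧ PB.tgt z = m := by
  constructor
  · intro h
    have h' : pullbackMap hφ p hp z = (𝒢.pullback p hp).one m := h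
    exact ⟨congrArg PB.src h', congrArg PB.mid h', congrArg PB.tgt h'⟩
  · rintro ⟨h1, h2, h3⟩
    exact PB.ext h1 h2 h3

theorem IsKerIso.pullback {R : LieGroupoid M} {φ : R.arr → 𝒢.arr} (hφ : IsMorphism R 𝒢 φ)
    {G : LieGrp.{u}} {m : M'} {b : G → R.arr} (hb : IsKerIso φ (p m) b)
    (b' : G → (R.pullback p hp).arr) (h1 : ∀ g, PB.src (b' g) = m) (h2 : ∀ g, PB.mid (b' g) = b g)
    (h3 : ∀ g, PB.tgt (b' g) = m) :
    IsKerIso (R := R.pullback p hp) (𝒢 := 𝒢.pullback p hp) (pullbackMap hφ p hp) m b' where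
  mem g := (mem_ker_pullbackMap p hp hφ m _).2 ⟨h1 g, by rw [h2]; exact hb.mem g, h3 g⟩
  mul g g' := by
    refine ⟨(h3 g).trans (h1 g').symm, PB.ext ((h1 _).trans (h1 _).symm) ?_
      ((h3 _).trans (h3 _).symm)⟩
    obtain ⟨h, e⟩ := hb.mul g g'
    refine (h2 _).trans (e.trans ?_)
    change _ = R.mul (PB.mid (b' g)) (PB.mid (b' g')) _
    simp only [h2]
  inj g g' h := hb.inj (by rw [← h2, ← h2, h])
  surj r hr := by
    obtain ⟨k1, k2, k3⟩ := (mem_ker_pullbackMap p hp hφ m r).1 hr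
    obtain ⟨g, hg⟩ := hb.surj _ k2
    exact ⟨g, PB.ext ((h1 g).trans k1.symm) ((h2 g).trans hg) ((h3 g).trans k3.symm)⟩

open Classical in
/-- The pull-back `R[p] → 𝒢[p]` of a `G`-extension `R → 𝒢`. -/
noncomputable def GExtension.pullback {G : LieGrp.{u}} (E : GExtension G 𝒢) :
    GExtension G (𝒢.pullback p hp) where
  R := E.R.pullback p hp
  φ := pullbackMap E.mor p hp
  mor := isMorphism_pullbackMap E.mor p hp
  surjSubm := surjSubm_pullbackMap p hp E.mor E.surjSubm
  locTriv x := by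
    obtain ⟨U, τ, σ, hU, hx, hτ, hσ, h⟩ := E.locTriv (p x)
    have hs : ∀ m : M', p m ∈ U → ∀ g, p m = E.R.s (τ (p m) g) := fun m hm g =>
      (E.mor.s_of_ker ((h _ hm).1.mem g)).symm
    have ht : ∀ m : M', p m ∈ U → ∀ g, E.R.t (τ (p m) g) = p m := fun m hm g =>
      E.mor.t_of_ker ((h _ hm).1.mem g)
    set τ' : M' → G → (E.R.pullback p hp).arr := fun m g =>
      if hm : p m ∈ U then PB.mk m (τ (p m) g) m (hs m hm g) (ht m hm g)
      else (E.R.pullback p hp).one m with hτ'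
    have e : ∀ m (hm : p m ∈ U) g,
        τ' m g = PB.mk m (τ (p m) g) m (hs m hm g) (ht m hm g) := fun m hm g => dif_pos hm
    refine ⟨p ⁻¹' U, τ', fun z => σ (PB.mid z), hU.preimage hp.smooth.continuous, hx, ?_, ?_, ?_⟩
    · have hpz : ContMDiff ((𝓡 M'.dim).prod (𝓡 G.toMfd.dim)) ((𝓡 M.dim).prod (𝓡 G.toMfd.dim)) ∞
          fun z : M' × G => (p z.1, z.2) :=
        (hp.smooth.comp contMDiff_fst).prodMk contMDiff_snd
      have h2 := hτ.comp hpz.contMDiffOn (s := (p ⁻¹' U) ×ˢ univ) fun z hz => ⟨hz.1, trivial⟩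
      refine PB.contMDiffOn hp (contMDiff_fst.contMDiffOn.congr fun z hz => ?_) (h2.congr fun z hz => ?_)
        (contMDiff_fst.contMDiffOn.congr fun z hz => ?_)
      · rw [e _ hz.1]; rfl
      · rw [e _ hz.1]; rfl
      · rw [e _ hz.1]; rfl
    · refine hσ.comp (PB.smooth_mid (𝒢 := E.R) hp).contMDiffOn ?_
      rintro z ⟨m, hm, hz⟩
      exact ⟨p m, hm, ((mem_ker_pullbackMap p hp E.mor m z).1 hz).2.1⟩
    · intro m hm
      refine ⟨IsKerIso.pullback p hp E.mor (h _ hm).1 (τ' m) (fun g => ?_) (fun g => ?_)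
        (fun g => ?_), fun g => ?_⟩
      · rw [e _ hm]; rfl
      · rw [e _ hm]; rfl
      · rw [e _ hm]; rfl
      · rw [e _ hm]; exact (h _ hm).2 g

/-- The pull-back `P ×_M M'` of a principal bundle over `R`, as a principal bundle over `R[p]`. The
action is `(n, r, n') · (x, n') = (r · x, n)`. -/
noncomputable def PrincipalBundle.pullback {H : LieGrp.{u}} {R : LieGroupoid M}
    (Q : PrincipalBundle H R) : PrincipalBundle H (R.pullback p hp) where
  P := FP Q.π p Q.hπ.subm hp.smooth
  π := FP.snd
  hπ := FP.surjSubm_snd Q.hπ hp.smooth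
  ract z h := FP.mk (Q.ract (FP.fst z) h) (FP.snd z) ((Q.π_ract _ _).trans (FP.w z))
  smooth_ract := by
    have l1 := (FP.smooth_fst (hf := Q.hπ.subm) (hg := hp.smooth)).comp
      (contMDiff_fst (N := H) (J := 𝓡 H.toMfd.dim))
    have l2 := (FP.smooth_snd (hf := Q.hπ.subm) (hg := hp.smooth)).comp
      (contMDiff_fst (N := H) (J := 𝓡 H.toMfd.dim))
    exact FP.contMDiff_iff.2 ⟨Q.smooth_ract.comp (l1.prodMk contMDiff_snd), l2⟩
  π_ract _ _ := rfl
  ract_one z := FP.ext (Q.ract_one _) rfl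
  ract_mul z h h' := FP.ext (Q.ract_mul _ _ _) rfl
  locTriv x := by
    classical
    obtain ⟨U, s, δ, hU, hx, hs, hδ, h1, h2⟩ := Q.locTriv (p x)
    set s' : M' → FPSet Q.π p := fun m =>
      if hm : p m ∈ U then FP.mk (s (p m)) m (h1 _ hm).1
      else FP.mk (Q.hπ.surj (p m)).choose m (Q.hπ.surj (p m)).choose_spec with hs'
    have e : ∀ m (hm : p m ∈ U), s' m = FP.mk (s (p m)) m (h1 _ hm).1 := fun m hm => dif_pos hm
    refine ⟨p ⁻¹' U, s', fun z => δ (FP.fst z), hU.preimage hp.smooth.continuous, hx, ?_, ?_,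
      fun m hm => ?_, fun z hz => ?_⟩
    · refine FP.contMDiffOn_iff.2 ⟨?_, ?_⟩
      · exact (hs.comp hp.smooth.contMDiffOn fun m hm => hm).congr fun m hm => by
          rw [e m hm]; rfl
      · exact contMDiff_id.contMDiffOn.congr fun m hm => by rw [e m hm]; rfl
    · refine hδ.comp FP.smooth_fst.contMDiffOn fun z hz => ?_
      change Q.π (FP.fst z) ∈ U
      rw [FP.w z]
      exact hz
    · rw [e m hm]
      exact ⟨rfl, (h1 _ hm).2⟩
    · have hz' : p (FP.snd z) ∈ U := hz
      rw [e _ hz']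
      refine FP.ext ?_ rfl
      have := h2 (FP.fst z) (by rw [FP.w z]; exact hz')
      simp only [FP.w z] at this
      exact this
  lact r z h := FP.mk (Q.lact (PB.mid r) (FP.fst z)
      ((PB.wt r).trans ((congrArg p h).trans (FP.w z).symm))) (PB.src r)
    ((Q.π_lact _ _ _).trans (PB.ws r).symm)
  smooth_lact := by
    have k1 := PB.surjSubm_tgt (𝒢 := R) hp
    have k2 := FP.surjSubm_snd Q.hπ hp.smooth
    have l1 := FP.smooth_fst (hf := k1.subm) (hg := k2.smooth)
    have l2 := FP.smooth_snd (hf := k1.subm) (hg := k2.smooth)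
    refine FP.contMDiff_iff.2 ⟨?_, (PB.smooth_src (𝒢 := R) hp).comp l1⟩
    exact Q.smooth_lact.comp (FP.contMDiff_iff.2
      ⟨(PB.smooth_mid (𝒢 := R) hp).comp l1,
        (FP.smooth_fst (hf := Q.hπ.subm) (hg := hp.smooth)).comp l2⟩ :
      Smooth (M := FP (M := PB R p hp) (N := FP Q.π p Q.hπ.subm hp.smooth) PB.tgt FP.snd
        k1.subm k2.smooth) (N := FP R.t Q.π R.ht.subm Q.hπ.smooth)
      fun z => FP.mk (PB.mid (FP.fst z)) (FP.fst (FP.snd z))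
        ((PB.wt _).trans ((congrArg p (FP.w z)).trans (FP.w (FP.snd z)).symm)))
  π_lact _ _ _ := rfl
  one_lact z := by
    refine FP.ext ?_ rfl
    have := Q.one_lact (FP.fst z)
    simp only [FP.w z] at this
    exact this
  mul_lact r r' z h h' := FP.ext (Q.mul_lact _ _ _ _ _) rfl
  lact_ract r z h k := FP.ext (Q.lact_ract _ _ _ _) rfl

/-- The isomorphism `g ↦ (m', b g, m')` from `G` onto the fibre over `m'` of the kernel of the
pulled back extension, where `b` is an isomorphism onto the fibre over `p m'`. -/
noncomputable def Band.pullback {G : LieGrp.{u}} {E : GExtension G 𝒢} {m : M} {m' : M'}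
    (b : Band E m) (h : m = p m') : Band (E.pullback p hp) m' where
  toFun g := PB.mk m' (b.toFun g) m' (h.symm.trans (b.s_eq g).symm) ((b.t_eq g).trans h)
  iso := by
    subst h
    exact IsKerIso.pullback p hp E.mor b.iso _ (fun _ => rfl) (fun _ => rfl) (fun _ => rfl)
  smooth := PB.contMDiff hp contMDiff_const b.smooth contMDiff_const
  smooth_inv := by
    subst h
    obtain ⟨σ, h1, h2⟩ := b.smooth_inv
    exact ⟨fun r => σ (PB.mid r), h1.comp (PB.smooth_mid (𝒢 := E.R) hp).contMDiffOn
      fun r hr => ((mem_ker_pullbackMap p hp E.mor _ r).1 hr).2.1, h2⟩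

/-- The pull-back `(R[p], P ×_M M', χ[p])` of a `G → H`-extension. -/
noncomputable def Extension.pullback {C : CrossedModule.{u}} (E : Extension C 𝒢) :
    Extension C (𝒢.pullback p hp) where
  ext := E.ext.pullback p hp
  bun := E.bun.pullback p hp
  χ := fun z : FPSet E.bun.π p => (E.χ (FP.fst z)).pullback p hp (FP.w z)
  smooth_χ := by
    have l := (FP.smooth_snd (hf := E.bun.hπ.subm) (hg := hp.smooth)).comp
      (contMDiff_fst (N := C.G) (J := 𝓡 C.G.toMfd.dim))
    refine PB.contMDiff hp l ?_ l
    exact E.smooth_χ.comp (((FP.smooth_fst (hf := E.bun.hπ.subm) (hg := hp.smooth)).comp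
      contMDiff_fst).prodMk contMDiff_snd)
  χ_ract z h g := PB.ext rfl (E.χ_ract _ _ _) rfl
  χ_lact r z h g := PB.ext rfl (E.χ_lact _ _ _ _) rfl
  ract_ρ z g := FP.ext (E.ract_ρ _ _) rfl

end pullback

end LieGroupoid
namespace LieGroupoid

/-- A `G → H`-extension over `B ⇉ B₀`: a surjective submersion `q : M → B₀` and a
`G → H`-extension of the pull-back groupoid `B[q] ⇉ M`. -/
structure ExtOver (C : CrossedModule.{u}) {B₀ : Mfd.{u}} (B : LieGroupoid B₀) where
  M : Mfd.{u}
  q : M → B₀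
  hq : SurjSubm q
  ext : Extension C (B.pullback q hq)

/-- The pull-back of a `G → H`-extension over `B` along `p : M' → M`, with base map `q ∘ p`, by
means of `B[q][p] ≅ B[q ∘ p]`. -/
noncomputable def ExtOver.pullback {C : CrossedModule.{u}} {B₀ : Mfd.{u}} {B : LieGroupoid B₀}
    (E : ExtOver C B) {M' : Mfd.{u}} (p : M' → E.M) (hp : SurjSubm p) : ExtOver C B where
  M := M'
  q x := E.q (p x)
  hq := E.hq.comp hp
  ext := (E.ext.pullback p hp).map (pullbackComp B E.q E.hq p hp)

/-- Morita equivalence of `G → H`-extensions over `B`: there are surjective submersions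
`p : M'' → M` and `p' : M'' → M'` with `q ∘ p = q' ∘ p'` such that the pull-backs along `p` and
`p'` are isomorphic extensions of `B[q ∘ p] = B[q' ∘ p']`. -/
def MoritaEq {C : CrossedModule.{u}} {B₀ : Mfd.{u}} {B : LieGroupoid B₀} (E E' : ExtOver C B) :
    Prop :=
  ∃ (M'' : Mfd.{u}) (p : M'' → E.M) (p' : M'' → E'.M) (hp : SurjSubm p) (hp' : SurjSubm p')
    (h : ∀ x, E.q (p x) = E'.q (p' x)),
    Nonempty (ExtIso
      ((E.pullback p hp).ext.map (pullbackCongr B (E.hq.comp hp) (E'.hq.comp hp') h))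
      (E'.pullback p' hp').ext)

/-- A `G → H`-gerbe over `B ⇉ B₀`: a Morita equivalence class of `G → H`-extensions over `B`. -/
def Gerbe (C : CrossedModule.{u}) {B₀ : Mfd.{u}} (B : LieGroupoid B₀) : Type (u + 1) :=
  Quot (MoritaEq (C := C) (B := B))

/-- The gerbe represented by an extension. -/
def Gerbe.mk {C : CrossedModule.{u}} {B₀ : Mfd.{u}} {B : LieGroupoid B₀} (E : ExtOver C B) :
    Gerbe C B :=
  Quot.mk _ E

/-- A Morita equivalence `(T, f, g, Φ)` of Lie groupoids: surjective submersions `f : T → B₀` and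
`g : T → B₀'` and an isomorphism `Φ : B[f] ≅ B'[g]` of Lie groupoids over the identity of `T`. -/
structure MoritaEquiv {B₀ B₀' : Mfd.{u}} (B : LieGroupoid B₀) (B' : LieGroupoid B₀') where
  T : Mfd.{u}
  f : T → B₀
  g : T → B₀'
  hf : SurjSubm f
  hg : SurjSubm g
  Φ : Iso (B.pullback f hf) (B'.pullback g hg)

namespace MoritaEquiv

variable {B₀ B₀' : Mfd.{u}} {B : LieGroupoid B₀} {B' : LieGroupoid B₀'}

/-- The inverse Morita equivalence `(T, g, f, Φ⁻¹)`. -/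
noncomputable def symm (𝓜 : MoritaEquiv B B') : MoritaEquiv B' B :=
  ⟨𝓜.T, 𝓜.g, 𝓜.f, 𝓜.hg, 𝓜.hf, 𝓜.Φ.symm⟩

section

variable (𝓜 : MoritaEquiv B B') {M : Mfd.{u}} (q : M → B₀) (hq : SurjSubm q)

/-- The manifold `M ×_{B₀} T`. -/
noncomputable def base : Mfd.{u} := FP q 𝓜.f hq.subm 𝓜.hf.smooth

/-- The projection `α : M ×_{B₀} T → M`. -/
noncomputable def α : 𝓜.base q hq → M := fun z : FPSet q 𝓜.f => FP.fst z

/-- The projection `β : M ×_{B₀} T → T`. -/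
noncomputable def β : 𝓜.base q hq → 𝓜.T := fun z : FPSet q 𝓜.f => FP.snd z

theorem surjSubm_α : SurjSubm (𝓜.α q hq) := FP.surjSubm_fst hq.subm 𝓜.hf

theorem surjSubm_β : SurjSubm (𝓜.β q hq) := FP.surjSubm_snd hq 𝓜.hf.smooth

/-- The isomorphism `B[q][α] ≅ B[q ∘ α] = B[f ∘ β] ≅ B[f][β] ≅ B'[g][β] ≅ B'[g ∘ β]` induced
by `Φ`, which maps `(x, (α x, b, α y), y)` to `(x, b', y)` with `Φ (β x, b, β y) = (β x, b', β y)`.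
-/
noncomputable def baseIso : Iso ((B.pullback q hq).pullback (𝓜.α q hq) (𝓜.surjSubm_α q hq))
    (B'.pullback (fun x => 𝓜.g (𝓜.β q hq x)) (𝓜.hg.comp (𝓜.surjSubm_β q hq))) :=
  (pullbackComp B q hq (𝓜.α q hq) (𝓜.surjSubm_α q hq)).trans <|
  (pullbackCongr B (hq.comp (𝓜.surjSubm_α q hq)) (𝓜.hf.comp (𝓜.surjSubm_β q hq))
    (fun z : FPSet q 𝓜.f => FP.w z)).trans <|
  (pullbackComp B 𝓜.f 𝓜.hf (𝓜.β q hq) (𝓜.surjSubm_β q hq)).symm.trans <|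
  (𝓜.Φ.pullback (𝓜.β q hq) (𝓜.surjSubm_β q hq)).trans <|
  pullbackComp B' 𝓜.g 𝓜.hg (𝓜.β q hq) (𝓜.surjSubm_β q hq)

end

/-- The `G → H`-extension over `B'` induced by a `G → H`-extension over `B` and a Morita
equivalence: the pull-back to `M ×_{B₀} T`, with base map `g ∘ β`. -/
noncomputable def transport (𝓜 : MoritaEquiv B B') {C : CrossedModule.{u}} (E : ExtOver C B) :
    ExtOver C B' where
  M := 𝓜.base E.q E.hq
  q x := 𝓜.g (𝓜.β E.q E.hq x)
  hq := 𝓜.hg.comp (𝓜.surjSubm_β E.q E.hq)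
  ext := (E.ext.pullback (𝓜.α E.q E.hq) (𝓜.surjSubm_α E.q E.hq)).map (𝓜.baseIso E.q E.hq)

/-- The defining property of `baseIso`. -/
theorem baseIso_apply (𝓜 : MoritaEquiv B B') {M : Mfd.{u}} (q : M → B₀) (hq : SurjSubm q)
    (z : ((B.pullback q hq).pullback (𝓜.α q hq) (𝓜.surjSubm_α q hq)).arr)
    (h : 𝓜.f (𝓜.β q hq (PB.src z)) = B.s (PB.mid (PB.mid z)))
    (h' : B.t (PB.mid (PB.mid z)) = 𝓜.f (𝓜.β q hq (PB.tgt z))) :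
    PB.src ((𝓜.baseIso q hq).toFun z) = PB.src z ∧ PB.tgt ((𝓜.baseIso q hq).toFun z) = PB.tgt z ∧
      PB.mid ((𝓜.baseIso q hq).toFun z) = PB.mid (𝓜.Φ.toFun
        (PB.mk (𝓜.β q hq (PB.src z)) (PB.mid (PB.mid z)) (𝓜.β q hq (PB.tgt z)) h h')) :=
  ⟨rfl, rfl, rfl⟩

end MoritaEquiv

end LieGroupoid

/-!
Transport commutes with pull-backs of extensions, so it respects Morita equivalence. Transporting
`E` along `𝓜` and then along the inverse of `𝓜` gives a pull-back of `E` as well, along the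
projection `((m, t), t') ↦ m` of `M ×_{B₀} T ×_{B₀'} T`; but its base map is `f t'` instead of
`q m = f t`. The unit arrows of `B'` at `g t = g t'` correspond under `Φ` to arrows of `B` which
link `f t` to `f t'`. After a surjective submersion these lift to arrows of the groupoid of `E`,
and conjugation by the lifts is an isomorphism with a pull-back of `E` over the map `f t'`.
-/

namespace Mfd

theorem surjSubm_id (M : Mfd.{u}) : SurjSubm fun x : M => x :=
  ⟨subm_of_hasSec contMDiff_id fun _ => ⟨fun y => y, contMDiffAt_id, rfl,
    Eventually.of_forall fun _ => rfl⟩, Function.surjective_id⟩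

theorem SurjSubm.of_comp {M N P : Mfd.{u}} {g : N → P} {e : M → N} {k : M → P} (hk : SurjSubm k)
    (hg : Smooth g) (he : Smooth e) (he' : Function.Surjective e) (h : ∀ x, g (e x) = k x) :
    SurjSubm g := by
  obtain rfl : (fun x => g (e x)) = k := funext h
  refine ⟨subm_of_hasSec hg fun y => ?_, fun z => (hk.surj z).imp' e fun _ hx => hx⟩
  obtain ⟨x, rfl⟩ := he' y
  obtain ⟨σ, hσ, hσx, hσ_sec⟩ := hk.subm.hasSec x
  exact ⟨fun z => e (σ z), he.contMDiffAt.comp _ hσ, congrArg e hσx, hσ_sec⟩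

end Mfd

theorem FP.surjSubm_mapFst {M M' N P : Mfd.{u}} {q : M → P} {f : N → P} (hq : Subm q)
    (hf : Smooth f) {p : M' → M} (hp : SurjSubm p) :
    SurjSubm (M := FP (fun x => q (p x)) f (hq.comp hp.subm) hf) (N := FP q f hq hf)
      fun z => FP.mk (p (FP.fst z)) (FP.snd z) (FP.w z) := by
  have smooth_fst : Smooth (M := FP q f hq hf) FP.fst := FP.smooth_fst
  have smooth_snd : Smooth (M := FP q f hq hf) FP.snd := FP.smooth_snd
  -- precomposed with `(x, z) ↦ (x, snd z)`, the map becomes the base change of `p` along `fst`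
  refine SurjSubm.of_comp (M := FP (N := FP q f hq hf) p FP.fst hp.subm smooth_fst)
    (e := fun w => FP.mk (FP.fst w) (FP.snd (FP.snd w))
      ((congrArg q (FP.w w)).trans (FP.w (FP.snd w))))
    (FP.surjSubm_snd hp smooth_fst)
    (FP.contMDiff_iff.2 ⟨hp.smooth.comp FP.smooth_fst, FP.smooth_snd⟩)
    (FP.contMDiff_iff.2 ⟨FP.smooth_fst, smooth_snd.comp FP.smooth_snd⟩)
    (fun z => ⟨FP.mk (FP.fst z) (FP.mk (p (FP.fst z)) (FP.snd z) (FP.w z)) rfl, rfl⟩)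
    fun w => FP.ext (FP.w w) rfl

namespace LieGroupoid

variable {M N : Mfd.{u}}

section Algebra

variable (R : LieGroupoid M)

-- In the primed lemmas the proofs of composability are arbitrary, so that they can be used to
-- rewrite inside longer products.

theorem mul_assoc' (x y z : R.arr) (h : R.t x = R.s y) (h' : R.t (R.mul x y h) = R.s z) :
    R.mul (R.mul x y h) z h' = R.mul x (R.mul y z ((R.t_mul x y h).symm.trans h'))
      (h.trans (R.s_mul y z _).symm) :=
  R.mul_assoc x y z h _

theorem one_mul' (m : M) (x : R.arr) (h : R.t (R.one m) = R.s x) : R.mul (R.one m) x h = x := by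
  obtain rfl : m = R.s x := (R.t_one m).symm.trans h
  exact R.one_mul x

theorem mul_one' (m : M) (x : R.arr) (h : R.t x = R.s (R.one m)) : R.mul x (R.one m) h = x := by
  obtain rfl : R.t x = m := h.trans (R.s_one m)
  exact R.mul_one x

theorem inv_mul_cancel_left (x y : R.arr) (h : R.t x = R.s y)
    (h' : R.t (R.inv x) = R.s (R.mul x y h)) : R.mul (R.inv x) (R.mul x y h) h' = y := by
  rw [← R.mul_assoc (R.inv x) x y (R.t_inv x) h]
  simp only [R.inv_mul, one_mul']

theorem mul_inv_cancel_left (x y : R.arr) (h : R.t (R.inv x) = R.s y)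
    (h' : R.t x = R.s (R.mul (R.inv x) y h)) : R.mul x (R.mul (R.inv x) y h) h' = y := by
  rw [← R.mul_assoc x (R.inv x) y (R.s_inv x).symm h]
  simp only [R.mul_inv, one_mul']

theorem eq_inv_of_mul_eq_one (x y : R.arr) (h : R.t x = R.s y)
    (hxy : R.mul x y h = R.one (R.s x)) : y = R.inv x := by
  rw [← R.inv_mul_cancel_left x y h ((R.t_inv x).trans (R.s_mul x y h).symm)]
  simp only [hxy, mul_one']

theorem inv_inv (x : R.arr) : R.inv (R.inv x) = x :=
  (R.eq_inv_of_mul_eq_one (R.inv x) x (R.t_inv x) (by rw [R.inv_mul, R.s_inv])).symm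

theorem inv_one (m : M) : R.inv (R.one m) = R.one m :=
  (R.eq_inv_of_mul_eq_one _ _ ((R.t_one m).trans (R.s_one m).symm)
    (by rw [one_mul', R.s_one])).symm

theorem inv_mul_mul_mul' (u w x y : R.arr) {v v' : R.arr} (hv : v = v') (hxy : R.t x = R.s y)
    (hu : R.t (R.inv u) = R.s (R.mul x y hxy))
    (hw : R.t (R.mul (R.inv u) (R.mul x y hxy) hu) = R.s w) (hux : R.t (R.inv u) = R.s x)
    (hxv : R.t (R.mul (R.inv u) x hux) = R.s v) (hvy : R.t (R.inv v') = R.s y)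
    (hyw : R.t (R.mul (R.inv v') y hvy) = R.s w)
    (h : R.t (R.mul (R.mul (R.inv u) x hux) v hxv) =
      R.s (R.mul (R.mul (R.inv v') y hvy) w hyw)) :
    R.mul (R.mul (R.inv u) (R.mul x y hxy) hu) w hw =
      R.mul (R.mul (R.mul (R.inv u) x hux) v hxv) (R.mul (R.mul (R.inv v') y hvy) w hyw) h := by
  subst hv
  simp only [mul_assoc', mul_inv_cancel_left]

theorem smooth_mul_of_smooth {X : Mfd.{u}} {c d : X → R.arr} (hc : Smooth c) (hd : Smooth d)
    (h : ∀ x, R.t (c x) = R.s (d x)) : Smooth fun x => R.mul (c x) (d x) (h x) :=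
  R.smooth_mul.comp (FP.contMDiff_iff.2 ⟨hc, hd⟩ :
    Smooth (N := FP R.t R.s R.ht.subm R.hs.smooth) fun x => FP.mk (c x) (d x) (h x))

end Algebra

theorem IsMorphism.map_inv {R S : LieGroupoid M} {φ : R.arr → S.arr} (hφ : IsMorphism R S φ)
    (x : R.arr) : φ (R.inv x) = S.inv (φ x) := by
  refine S.eq_inv_of_mul_eq_one _ _
    ((hφ.t_map x).trans ((R.s_inv x).symm.trans (hφ.s_map _).symm)) ?_
  rw [← hφ.map_mul x (R.inv x) (R.s_inv x).symm, R.mul_inv, hφ.map_one, hφ.s_map]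

/-- The identity isomorphism of a Lie groupoid. -/
noncomputable def Iso.refl (R : LieGroupoid M) : Iso R R :=
  ⟨id, id, fun _ => rfl, fun _ => rfl,
    ⟨contMDiff_id, fun _ => rfl, fun _ => rfl, fun _ _ _ => rfl⟩,
    ⟨contMDiff_id, fun _ => rfl, fun _ => rfl, fun _ _ _ => rfl⟩⟩

namespace PrincipalBundle

variable {H : LieGrp.{u}} {R : LieGroupoid M} (Q : PrincipalBundle H R)

theorem one_lact' (m : M) (p : Q.P) (h : R.t (R.one m) = Q.π p) :
    Q.lact (R.one m) p h = p := by
  obtain rfl : m = Q.π p := (R.t_one m).symm.trans h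
  exact Q.one_lact p

theorem lact_lact (r r' : R.arr) (p : Q.P) (h' : R.t r' = Q.π p)
    (h : R.t r = Q.π (Q.lact r' p h')) :
    Q.lact r (Q.lact r' p h') h = Q.lact (R.mul r r' (h.trans (Q.π_lact _ _ _))) p
      ((R.t_mul _ _ _).trans h') :=
  (Q.mul_lact r r' p (h.trans (Q.π_lact _ _ _)) h').symm

theorem lact_inv_lact (r : R.arr) (p : Q.P) (h : R.t r = Q.π p)
    (h' : R.t (R.inv r) = Q.π (Q.lact r p h)) : Q.lact (R.inv r) (Q.lact r p h) h' = p := by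
  simp only [lact_lact, R.inv_mul, one_lact']

theorem lact_lact_inv (r : R.arr) (p : Q.P) (h : R.t (R.inv r) = Q.π p)
    (h' : R.t r = Q.π (Q.lact (R.inv r) p h)) : Q.lact r (Q.lact (R.inv r) p h) h' = p := by
  simp only [lact_lact, R.mul_inv, one_lact']

theorem lact_lact_eq_lact_mul_mul_lact_inv (u r : R.arr) (p : Q.P) {v v' : R.arr} (hv : v = v')
    (hr : R.t r = Q.π p) (hu : R.t u = Q.π (Q.lact r p hr)) (hur : R.t u = R.s r)
    (hrv : R.t (R.mul u r hur) = R.s v) (hv' : R.t (R.inv v') = Q.π p)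
    (h : R.t (R.mul (R.mul u r hur) v hrv) = Q.π (Q.lact (R.inv v') p hv')) :
    Q.lact u (Q.lact r p hr) hu =
      Q.lact (R.mul (R.mul u r hur) v hrv) (Q.lact (R.inv v') p hv') h := by
  subst hv
  simp only [lact_lact, mul_assoc', R.mul_inv, mul_one']

theorem smooth_lact_of_smooth {X : Mfd.{u}} {c : X → R.arr} {d : X → Q.P} (hc : Smooth c)
    (hd : Smooth d) (h : ∀ x, R.t (c x) = Q.π (d x)) :
    Smooth fun x => Q.lact (c x) (d x) (h x) :=
  Q.smooth_lact.comp (FP.contMDiff_iff.2 ⟨hc, hd⟩ :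
    Smooth (N := FP R.t Q.π R.ht.subm Q.hπ.smooth) fun x => FP.mk (c x) (d x) (h x))

end PrincipalBundle

/-- A smooth family of arrows `γ x` of `R` from `a x` to `b x`. When `a` and `b` are surjective
submersions, conjugation by `γ` identifies the pull-backs `R[a]` and `R[b]`. -/
@[ext]
structure ArrowFamily (R : LieGroupoid M) (a b : N → M) where
  toFun : N → R.arr
  smooth : Smooth toFun
  s_eq : ∀ x, R.s (toFun x) = a x
  t_eq : ∀ x, R.t (toFun x) = b x

namespace ArrowFamily

variable {R S : LieGroupoid M} {a b : N → M}

/-- The family of inverse arrows. -/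
noncomputable def inv (c : ArrowFamily R a b) : ArrowFamily R b a where
  toFun x := R.inv (c.toFun x)
  smooth := R.smooth_inv.comp c.smooth
  s_eq x := (R.s_inv _).trans (c.t_eq x)
  t_eq x := (R.t_inv _).trans (c.s_eq x)

theorem inv_inv (c : ArrowFamily R a b) : c.inv.inv = c :=
  ArrowFamily.ext (funext fun _ => R.inv_inv _)

/-- The family of unit arrows along `a`. The second map is only required to agree with `a`
pointwise. -/
noncomputable def ofEq (R : LieGroupoid M) (ha : Smooth a) (h : ∀ x, a x = b x) :
    ArrowFamily R a b where
  toFun x := R.one (a x)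
  smooth := R.smooth_one.comp ha
  s_eq _ := R.s_one _
  t_eq x := (R.t_one _).trans (h x)

/-- The image of a family of arrows under a morphism. -/
noncomputable def map {φ : R.arr → S.arr} (hφ : IsMorphism R S φ) (c : ArrowFamily R a b) :
    ArrowFamily S a b where
  toFun x := φ (c.toFun x)
  smooth := hφ.smooth.comp c.smooth
  s_eq x := (hφ.s_map _).trans (c.s_eq x)
  t_eq x := (hφ.t_map _).trans (c.t_eq x)

/-- The precomposition of a family of arrows with a smooth map. -/
noncomputable def comp (c : ArrowFamily R a b) {W : Mfd.{u}} {w : W → N} (hw : Smooth w) :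
    ArrowFamily R (fun x => a (w x)) (fun x => b (w x)) where
  toFun x := c.toFun (w x)
  smooth := c.smooth.comp hw
  s_eq x := c.s_eq (w x)
  t_eq x := c.t_eq (w x)

/-- The family of arrows `(a x, c x, b x)` of a pull-back `R[p]`. -/
noncomputable def toPullback {K : Mfd.{u}} {p : K → M} {a' b' : N → K} (c : ArrowFamily R a b)
    (hp : SurjSubm p) (ha' : Smooth a') (hb' : Smooth b') (ha : ∀ x, p (a' x) = a x)
    (hb : ∀ x, p (b' x) = b x) : ArrowFamily (R.pullback p hp) a' b' where
  toFun x := PB.mk (a' x) (c.toFun x) (b' x) ((ha x).trans (c.s_eq x).symm)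
    ((c.t_eq x).trans (hb x).symm)
  smooth := PB.contMDiff hp ha' c.smooth hb'
  s_eq _ := rfl
  t_eq _ := rfl

/-- The family of arrows of `R` underlying a family of arrows of `R[p]`. -/
noncomputable def mid {K : Mfd.{u}} {p : K → M} {hp : SurjSubm p} {a' b' : N → K}
    (c : ArrowFamily (R.pullback p hp) a' b') :
    ArrowFamily R (fun x => p (a' x)) (fun x => p (b' x)) where
  toFun x := PB.mid (c.toFun x)
  smooth := (PB.smooth_mid hp).comp c.smooth
  s_eq x := (PB.ws (c.toFun x)).symm.trans (congrArg p (c.s_eq x))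
  t_eq x := (PB.wt (c.toFun x)).trans (congrArg p (c.t_eq x))

theorem exists_lift {φ : R.arr → S.arr} (hφ : IsMorphism R S φ) (hφ' : SurjSubm φ)
    (c : ArrowFamily S a b) : ∃ (W : Mfd.{u}) (w : W → N) (hw : SurjSubm w)
      (γ : ArrowFamily R (fun x => a (w x)) fun x => b (w x)), γ.map hφ = c.comp hw.smooth := by
  have hγ (x : FPSet φ c.toFun) : φ (FP.fst x) = c.toFun (FP.snd x) := FP.w x
  exact ⟨FP φ c.toFun hφ'.subm c.smooth, FP.snd, FP.surjSubm_snd hφ' c.smooth,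
    { toFun := FP.fst
      smooth := FP.smooth_fst
      s_eq := fun x => (hφ.s_map _).symm.trans ((congrArg S.s (hγ x)).trans (c.s_eq _))
      t_eq := fun x => (hφ.t_map _).symm.trans ((congrArg S.t (hγ x)).trans (c.t_eq _)) },
    ArrowFamily.ext (funext hγ)⟩

section Conj

variable (c : ArrowFamily R a b) (ha : SurjSubm a) (hb : SurjSubm b)

/-- The map `(x, r, y) ↦ (x, (c x)⁻¹ r (c y), y)` from `R[a]` to `R[b]`. -/
noncomputable def conj (z : (R.pullback a ha).arr) : (R.pullback b hb).arr :=
  PB.mk (PB.src z) (R.mul (R.mul (R.inv (c.toFun (PB.src z))) (PB.mid z)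
      ((R.t_inv _).trans ((c.s_eq _).trans (PB.ws z)))) (c.toFun (PB.tgt z))
      ((R.t_mul _ _ _).trans ((PB.wt z).trans (c.s_eq _).symm))) (PB.tgt z)
    ((c.t_eq _).symm.trans
      ((R.s_inv _).symm.trans ((R.s_mul _ _ _).symm.trans (R.s_mul _ _ _).symm)))
    ((R.t_mul _ _ _).trans (c.t_eq _))

theorem isMorphism_conj : IsMorphism (R.pullback a ha) (R.pullback b hb) (c.conj ha hb) where
  smooth := by
    refine PB.contMDiff hb (PB.smooth_src ha) ?_ (PB.smooth_tgt ha)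
    exact R.smooth_mul_of_smooth (R.smooth_mul_of_smooth
      (c.inv.smooth.comp (PB.smooth_src ha)) (PB.smooth_mid ha) _)
      (c.smooth.comp (PB.smooth_tgt ha)) _
  s_map _ := rfl
  t_map _ := rfl
  map_mul _ _ h :=
    PB.ext rfl (R.inv_mul_mul_mul' _ _ _ _ (congrArg c.toFun h) _ _ _ _ _ _ _ _) rfl

theorem conj_inv_conj (z : (R.pullback a ha).arr) : c.inv.conj hb ha (c.conj ha hb z) = z := by
  refine PB.ext rfl ?_ rfl
  change R.mul (R.mul (R.inv (R.inv (c.toFun (PB.src z)))) (R.mul (R.mul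
    (R.inv (c.toFun (PB.src z))) (PB.mid z) _) (c.toFun (PB.tgt z)) _) _)
    (R.inv (c.toFun (PB.tgt z))) _ = PB.mid z
  simp only [mul_assoc', LieGroupoid.inv_inv, R.mul_inv, mul_one', mul_inv_cancel_left]

/-- The isomorphism of pull-backs `R[a] ≅ R[b]` given by conjugation. -/
noncomputable def conjIso : Iso (R.pullback a ha) (R.pullback b hb) where
  toFun := c.conj ha hb
  invFun := c.inv.conj hb ha
  left_inv := c.conj_inv_conj ha hb
  right_inv z := by simpa only [inv_inv] using c.inv.conj_inv_conj hb ha z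
  mor := c.isMorphism_conj ha hb
  mor_inv := c.inv.isMorphism_conj hb ha

theorem pullbackMap_conj {φ : R.arr → S.arr} (hφ : IsMorphism R S φ)
    (z : (R.pullback a ha).arr) : pullbackMap hφ b hb (c.conj ha hb z) =
      (c.map hφ).conj ha hb (pullbackMap hφ a ha z) := by
  refine PB.ext rfl ?_ rfl
  change φ (R.mul (R.mul (R.inv (c.toFun (PB.src z))) (PB.mid z) _) (c.toFun (PB.tgt z)) _) =
    S.mul (S.mul (S.inv (φ (c.toFun (PB.src z)))) (φ (PB.mid z)) _) (φ (c.toFun (PB.tgt z))) _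
  simp only [hφ.map_mul, hφ.map_inv]

theorem mid_conj_ofEq (h : ∀ x, a x = b x) (z : (R.pullback a ha).arr) :
    PB.mid ((ofEq R ha.smooth h).conj ha hb z) = PB.mid z := by
  change R.mul (R.mul (R.inv (R.one _)) (PB.mid z) _) (R.one _) _ = PB.mid z
  simp only [inv_one, one_mul', mul_one']

theorem mid_conj_toPullback {K : Mfd.{u}} {p : K → M} {a' b' : N → K} (hp : SurjSubm p)
    (ha' : SurjSubm a') (hb' : SurjSubm b') (h : ∀ x, p (a' x) = a x) (h' : ∀ x, p (b' x) = b x)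
    (z : ((R.pullback p hp).pullback a' ha').arr) (hs : a (PB.src z) = R.s (PB.mid (PB.mid z)))
    (ht : R.t (PB.mid (PB.mid z)) = a (PB.tgt z)) :
    PB.mid (PB.mid ((c.toPullback hp ha'.smooth hb'.smooth h h').conj ha' hb' z)) =
      PB.mid (c.conj ha hb (PB.mk (PB.src z) (PB.mid (PB.mid z)) (PB.tgt z) hs ht)) :=
  rfl

end Conj

end ArrowFamily

variable {K : Mfd.{u}} {C : CrossedModule.{u}}

/-- The extension `E[a]`, transported along an identification `Λ` of its base groupoid `𝒢[a]`.
Every extension that is compared here is of this form, for varying `a` and `Λ`. -/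
noncomputable abbrev Extension.pullbackAlong {𝒢 : LieGroupoid M} (E : Extension C 𝒢) {a : N → M}
    (ha : SurjSubm a) {𝓗 : LieGroupoid N} (Λ : Iso (𝒢.pullback a ha) 𝓗) : Extension C 𝓗 :=
  (E.pullback a ha).map Λ

namespace ExtIso

variable {𝒢 𝒢' : LieGroupoid M} {E E' E'' : Extension C 𝒢}

/-- The identity isomorphism. -/
noncomputable def refl (E : Extension C 𝒢) : ExtIso E E where
  Φ := Iso.refl _
  φ_Φ _ := rfl
  Ψ := id
  Ψinv := id
  left_inv _ := rfl
  right_inv _ := rfl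
  smooth_Ψ := contMDiff_id
  smooth_Ψinv := contMDiff_id
  π_Ψ _ := rfl
  Ψ_ract _ _ := rfl
  Ψ_lact _ _ _ := rfl
  χ_Ψ _ _ := rfl

/-- The inverse isomorphism. -/
noncomputable def symm (I : ExtIso E E') : ExtIso E' E where
  Φ := I.Φ.symm
  φ_Φ r := by
    rw [← I.φ_Φ]
    exact congrArg _ (I.Φ.right_inv r)
  Ψ := I.Ψinv
  Ψinv := I.Ψ
  left_inv := I.right_inv
  right_inv := I.left_inv
  smooth_Ψ := I.smooth_Ψinv
  smooth_Ψinv := I.smooth_Ψ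
  π_Ψ p := by rw [← I.π_Ψ, I.right_inv]
  Ψ_ract p h := by
    conv_lhs => rw [← I.right_inv p, ← I.Ψ_ract, I.left_inv]
  Ψ_lact r p h := by
    refine (Function.LeftInverse.injective I.left_inv) ?_
    rw [I.right_inv, I.Ψ_lact]
    change _ = E'.bun.lact (I.Φ.toFun (I.Φ.invFun r)) (I.Ψ (I.Ψinv p)) _
    simp only [I.Φ.right_inv, I.right_inv]
  χ_Ψ p g := by
    have hχ := I.χ_Ψ (I.Ψinv p) g
    rw [I.right_inv] at hχ
    exact (I.Φ.left_inv _).symm.trans (congrArg I.Φ.invFun hχ.symm)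

/-- Composition of isomorphisms. -/
noncomputable def trans (I : ExtIso E E') (J : ExtIso E' E'') : ExtIso E E'' where
  Φ := I.Φ.trans J.Φ
  φ_Φ r := (J.φ_Φ _).trans (I.φ_Φ r)
  Ψ p := J.Ψ (I.Ψ p)
  Ψinv p := I.Ψinv (J.Ψinv p)
  left_inv p := by rw [J.left_inv, I.left_inv]
  right_inv p := by rw [I.right_inv, J.right_inv]
  smooth_Ψ := J.smooth_Ψ.comp I.smooth_Ψ
  smooth_Ψinv := I.smooth_Ψinv.comp J.smooth_Ψinv
  π_Ψ p := (J.π_Ψ _).trans (I.π_Ψ p)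
  Ψ_ract p h := by rw [I.Ψ_ract, J.Ψ_ract]
  Ψ_lact r p h := by rw [I.Ψ_lact, J.Ψ_lact]; rfl
  χ_Ψ p g := by rw [J.χ_Ψ, I.χ_Ψ]; rfl

/-- Transport of an isomorphism of extensions along an isomorphism of groupoids. -/
noncomputable def map (I : ExtIso E E') (Θ : Iso 𝒢 𝒢') : ExtIso (E.map Θ) (E'.map Θ) where
  Φ := I.Φ
  φ_Φ r := congrArg Θ.toFun (I.φ_Φ r)
  Ψ := I.Ψ
  Ψinv := I.Ψinv
  left_inv := I.left_inv
  right_inv := I.right_inv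
  smooth_Ψ := I.smooth_Ψ
  smooth_Ψinv := I.smooth_Ψinv
  π_Ψ := I.π_Ψ
  Ψ_ract := I.Ψ_ract
  Ψ_lact := I.Ψ_lact
  χ_Ψ := I.χ_Ψ

/-- The identity, as an isomorphism between transports along isomorphisms with the same underlying
map. -/
noncomputable def mapCongr (E : Extension C 𝒢) {Θ Θ' : Iso 𝒢 𝒢'}
    (h : ∀ x, Θ'.toFun x = Θ.toFun x) : ExtIso (E.map Θ) (E.map Θ') where
  Φ := Iso.refl _
  φ_Φ _ := h _
  Ψ := id
  Ψinv := id
  left_inv _ := rfl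
  right_inv _ := rfl
  smooth_Ψ := contMDiff_id
  smooth_Ψinv := contMDiff_id
  π_Ψ _ := rfl
  Ψ_ract _ _ := rfl
  Ψ_lact _ _ _ := rfl
  χ_Ψ _ _ := rfl

/-- Pull-back of an isomorphism of extensions. -/
noncomputable def pullback (I : ExtIso E E') (p : N → M) (hp : SurjSubm p) :
    ExtIso (E.pullback p hp) (E'.pullback p hp) where
  Φ := I.Φ.pullback p hp
  φ_Φ _ := PB.ext rfl (I.φ_Φ _) rfl
  Ψ z := FP.mk (I.Ψ (FP.fst z)) (FP.snd z) ((I.π_Ψ _).trans (FP.w z))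
  Ψinv z := FP.mk (I.Ψinv (FP.fst z)) (FP.snd z) ((I.symm.π_Ψ _).trans (FP.w z))
  left_inv _ := FP.ext (I.left_inv _) rfl
  right_inv _ := FP.ext (I.right_inv _) rfl
  smooth_Ψ := FP.contMDiff_iff.2 ⟨I.smooth_Ψ.comp FP.smooth_fst, FP.smooth_snd⟩
  smooth_Ψinv := FP.contMDiff_iff.2 ⟨I.smooth_Ψinv.comp FP.smooth_fst, FP.smooth_snd⟩
  π_Ψ _ := rfl
  Ψ_ract _ _ := FP.ext (I.Ψ_ract _ _) rfl
  Ψ_lact _ _ _ := FP.ext (I.Ψ_lact _ _ _) rfl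
  χ_Ψ _ _ := PB.ext rfl (I.χ_Ψ _ _) rfl

section PullbackAlong

variable {𝓗 : LieGroupoid N} {a : N → M}

/-- The canonical isomorphism `E[a][b] ≅ E[a ∘ b]`. -/
noncomputable def pullbackPullbackAlong (E : Extension C 𝒢) {ha : SurjSubm a}
    (Λ : Iso (𝒢.pullback a ha) 𝓗) {b : K → N} (hb : SurjSubm b) :
    ExtIso ((E.pullbackAlong ha Λ).pullback b hb)
      (E.pullbackAlong (ha.comp hb) ((pullbackComp 𝒢 a ha b hb).symm.trans (Λ.pullback b hb))) where
  Φ := pullbackComp E.ext.R a ha b hb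
  φ_Φ r := PB.ext rfl (congrArg Λ.toFun (PB.ext (PB.ws r) rfl (PB.wt r).symm)) rfl
  Ψ z := FP.mk (FP.fst (FP.fst z)) (FP.snd z) ((FP.w (FP.fst z)).trans (congrArg a (FP.w z)))
  Ψinv z := FP.mk (FP.mk (FP.fst z) (b (FP.snd z)) (FP.w z)) (FP.snd z) rfl
  left_inv z := FP.ext (FP.ext rfl (FP.w z).symm) rfl
  right_inv _ := rfl
  smooth_Ψ := FP.contMDiff_iff.2 ⟨(FP.smooth_fst (hf := E.bun.hπ.subm) (hg := ha.smooth)).comp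
    (FP.smooth_fst (hf := (E.pullbackAlong ha Λ).bun.hπ.subm) (hg := hb.smooth)), FP.smooth_snd⟩
  smooth_Ψinv := FP.contMDiff_iff.2 ⟨FP.contMDiff_iff.2 ⟨FP.smooth_fst,
    hb.smooth.comp FP.smooth_snd⟩, FP.smooth_snd⟩
  π_Ψ _ := rfl
  Ψ_ract _ _ := rfl
  Ψ_lact _ _ _ := rfl
  χ_Ψ _ _ := rfl

/-- The isomorphism `X[b] ≅ E[a][b] ≅ E[a ∘ b]` induced by an isomorphism `X ≅ E[a]`, with the
base groupoid of `X[b]` identified with `𝓚`. -/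
noncomputable def pullbackAlongTrans {E : Extension C 𝒢} {ha : SurjSubm a} {X : Extension C 𝓗}
    {Λ : Iso (𝒢.pullback a ha) 𝓗} (I : ExtIso X (E.pullbackAlong ha Λ)) {b : K → N}
    (hb : SurjSubm b) {𝓚 : LieGroupoid K} (Ω : Iso (𝓗.pullback b hb) 𝓚) :
    ExtIso (X.pullbackAlong hb Ω) (E.pullbackAlong (ha.comp hb)
      (((pullbackComp 𝒢 a ha b hb).symm.trans (Λ.pullback b hb)).trans Ω)) :=
  ((I.pullback b hb).trans (pullbackPullbackAlong E Λ hb)).map Ω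

/-- The isomorphism `E[a] ≅ E[b]` given by conjugation with a smooth family of arrows from `a x`
to `b x`. -/
noncomputable def conj (E : Extension C 𝒢) {b : N → M} {ha : SurjSubm a} {hb : SurjSubm b}
    (γ : ArrowFamily E.ext.R a b) (Λ : Iso (𝒢.pullback a ha) 𝓗)
    (Λ' : Iso (𝒢.pullback b hb) 𝓗)
    (h : ∀ z, Λ'.toFun ((γ.map E.ext.mor).conj ha hb z) = Λ.toFun z) :
    ExtIso (E.pullbackAlong ha Λ) (E.pullbackAlong hb Λ') where
  Φ := γ.conjIso ha hb
  φ_Φ r := (congrArg Λ'.toFun (γ.pullbackMap_conj ha hb E.ext.mor r)).trans (h _)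
  Ψ z := FP.mk (E.bun.lact (E.ext.R.inv (γ.toFun (FP.snd z))) (FP.fst z)
      ((γ.inv.t_eq _).trans (FP.w z).symm)) (FP.snd z)
    ((E.bun.π_lact _ _ _).trans (γ.inv.s_eq _))
  Ψinv z := FP.mk (E.bun.lact (γ.toFun (FP.snd z)) (FP.fst z)
      ((γ.t_eq _).trans (FP.w z).symm)) (FP.snd z)
    ((E.bun.π_lact _ _ _).trans (γ.s_eq _))
  left_inv _ := FP.ext (E.bun.lact_lact_inv _ _ _ _) rfl
  right_inv _ := FP.ext (E.bun.lact_inv_lact _ _ _ _) rfl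
  smooth_Ψ := FP.contMDiff_iff.2 ⟨E.bun.smooth_lact_of_smooth
    (γ.inv.smooth.comp FP.smooth_snd) FP.smooth_fst _, FP.smooth_snd⟩
  smooth_Ψinv := FP.contMDiff_iff.2 ⟨E.bun.smooth_lact_of_smooth
    (γ.smooth.comp FP.smooth_snd) FP.smooth_fst _, FP.smooth_snd⟩
  π_Ψ _ := rfl
  Ψ_ract _ _ := FP.ext (E.bun.lact_ract _ _ _ _).symm rfl
  Ψ_lact _ _ h := FP.ext (E.bun.lact_lact_eq_lact_mul_mul_lact_inv _ _ _
    (congrArg γ.toFun h) _ _ _ _ _ _) rfl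
  χ_Ψ z g := PB.ext rfl (by
    refine (E.χ_lact _ _ _ _).trans ?_
    simp only [LieGroupoid.conj, inv_inv]
    rfl) rfl

end PullbackAlong

end ExtIso

variable {B₀ B₀' : Mfd.{u}} {B : LieGroupoid B₀} {B' : LieGroupoid B₀'}

theorem Iso.toFun_eq_toFun {R R' : LieGroupoid M} {q : M → B₀} {hq : SurjSubm q}
    (Θ : Iso R (B.pullback q hq)) (Θ' : Iso R' (B.pullback q hq)) {r : R.arr} {r' : R'.arr}
    (hs : R.s r = R'.s r') (ht : R.t r = R'.t r')
    (h : PB.mid (Θ.toFun r) = PB.mid (Θ'.toFun r')) : Θ.toFun r = Θ'.toFun r' :=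
  PB.ext ((Θ.mor.s_map r).trans (hs.trans (Θ'.mor.s_map r').symm)) h
    ((Θ.mor.t_map r).trans (ht.trans (Θ'.mor.t_map r').symm))

theorem moritaEq_of_extIso {q : M → B₀} {hq : SurjSubm q} {E E' : Extension C (B.pullback q hq)}
    (I : ExtIso E E') : MoritaEq ⟨M, q, hq, E⟩ ⟨M, q, hq, E'⟩ :=
  ⟨M, id, id, surjSubm_id M, surjSubm_id M, fun _ => rfl,
    ⟨(ExtIso.mapCongr (Θ := pullbackComp B q hq _ _) _ fun _ => rfl).trans
      ((I.pullback _ (surjSubm_id M)).map _)⟩⟩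

/-- `hc` says that conjugation by `c` is the canonical identification of the base groupoids. -/
theorem moritaEq_of_arrowFamily {X E : ExtOver C B} {a : X.M → E.M} {ha : SurjSubm a}
    {Λ : Iso ((B.pullback E.q E.hq).pullback a ha) (B.pullback X.q X.hq)}
    (I : ExtIso X.ext (E.ext.pullbackAlong ha Λ)) {Y : Mfd.{u}} {y₁ : Y → X.M} {y₂ : Y → E.M}
    (hy₁ : SurjSubm y₁) (hy₂ : SurjSubm y₂) (h : ∀ y, X.q (y₁ y) = E.q (y₂ y))
    (c : ArrowFamily (B.pullback E.q E.hq) (fun y => a (y₁ y)) y₂)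
    (hc : ∀ z, PB.mid (PB.mid (c.conj (ha.comp hy₁) hy₂ z)) =
      PB.mid (Λ.toFun (PB.mid ((pullbackComp (B.pullback E.q E.hq) a ha y₁ hy₁).invFun z)))) :
    MoritaEq X E := by
  obtain ⟨W, w, hw, γ, hγ⟩ := c.exists_lift E.ext.ext.mor E.ext.ext.surjSubm
  refine ⟨W, fun x => y₁ (w x), fun x => y₂ (w x), hy₁.comp hw, hy₂.comp hw, fun x => h (w x),
    ⟨(I.pullbackAlongTrans (hy₁.comp hw) ((pullbackComp B X.q X.hq _ _).trans
      (pullbackCongr B _ (E.hq.comp (hy₂.comp hw)) fun x => h (w x)))).trans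
      (ExtIso.conj E.ext γ _ _ fun z => ?_)⟩⟩
  rw [hγ]
  refine Iso.toFun_eq_toFun _ _ rfl rfl ?_
  exact hc (PB.mk (w (PB.src z)) (PB.mid z) (w (PB.tgt z)) (PB.ws z) (PB.wt z))

namespace MoritaEquiv

variable (𝓜 : MoritaEquiv B B')

section Link

variable {X : Mfd.{u}} {a b : X → 𝓜.T}

/-- The arrows of `B[f]` from `a x` to `b x` that correspond under `Φ` to the unit arrows of `B'`
at `g (a x) = g (b x)`. -/
noncomputable def link (ha : Smooth a) (hb : Smooth b) (h : ∀ x, 𝓜.g (a x) = 𝓜.g (b x)) :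
    ArrowFamily (B.pullback 𝓜.f 𝓜.hf) a b :=
  ((ArrowFamily.ofEq B' (𝓜.hg.smooth.comp ha) h).toPullback 𝓜.hg ha hb (fun _ => rfl)
    fun _ => rfl).map 𝓜.Φ.mor_inv

theorem mid_conj_link (ha : SurjSubm a) (hb : SurjSubm b) (h : ∀ x, 𝓜.g (a x) = 𝓜.g (b x))
    (z : ((B.pullback 𝓜.f 𝓜.hf).pullback a ha).arr)
    (hs : 𝓜.g (b (PB.src z)) = B'.s (PB.mid (𝓜.Φ.toFun (PB.mid z))))
    (ht : B'.t (PB.mid (𝓜.Φ.toFun (PB.mid z))) = 𝓜.g (b (PB.tgt z))) :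
    PB.mid ((𝓜.link ha.smooth hb.smooth h).conj ha hb z) =
      𝓜.Φ.invFun (PB.mk (b (PB.src z)) (PB.mid (𝓜.Φ.toFun (PB.mid z))) (b (PB.tgt z)) hs ht) := by
  let c := ArrowFamily.ofEq B' (𝓜.hg.comp ha).smooth h
  let c' := c.toPullback 𝓜.hg ha.smooth hb.smooth (fun _ => rfl) fun _ => rfl
  let z' := pullbackMap 𝓜.Φ.mor a ha z
  have hz : pullbackMap 𝓜.Φ.mor_inv a ha z' = z := PB.ext rfl (𝓜.Φ.left_inv _) rfl
  have h_conj : PB.mid (c'.conj ha hb z') =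
      PB.mk (b (PB.src z)) (PB.mid (𝓜.Φ.toFun (PB.mid z))) (b (PB.tgt z)) hs ht := by
    refine PB.ext rfl ?_ rfl
    exact (c.mid_conj_toPullback (𝓜.hg.comp ha) (𝓜.hg.comp hb) 𝓜.hg ha hb _ _ z'
      ((congrArg 𝓜.g (PB.ws z')).trans (PB.ws (PB.mid z')))
      ((PB.wt (PB.mid z')).trans (congrArg 𝓜.g (PB.wt z')))).trans
      (ArrowFamily.mid_conj_ofEq _ _ h _)
  rw [← h_conj]
  refine (congrArg PB.mid ?_).trans
    (congrArg PB.mid (c'.pullbackMap_conj ha hb 𝓜.Φ.mor_inv z')).symm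
  rw [hz]
  rfl

end Link

theorem moritaEq_transport {M : Mfd.{u}} {q q' : M → B₀} {hq : SurjSubm q} {hq' : SurjSubm q'}
    (h : ∀ x, q x = q' x) {E : Extension C (B.pullback q hq)} {E' : Extension C (B.pullback q' hq')}
    (I : ExtIso (E.map (pullbackCongr B hq hq' h)) E') :
    MoritaEq (𝓜.transport ⟨M, q, hq, E⟩) (𝓜.transport ⟨M, q', hq', E'⟩) := by
  obtain rfl : q = q' := funext h
  let J : ExtIso E E' := (ExtIso.mapCongr (Θ := Iso.refl _) E fun _ => rfl).trans I
  exact moritaEq_of_extIso ((J.pullback _ (𝓜.surjSubm_α q hq)).map (𝓜.baseIso q hq))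

theorem moritaEq_transport_pullback (E : ExtOver C B) {M' : Mfd.{u}} (p : M' → E.M)
    (hp : SurjSubm p) : MoritaEq (𝓜.transport E) (𝓜.transport (E.pullback p hp)) := by
  have hp' := FP.surjSubm_mapFst E.hq.subm 𝓜.hf.smooth hp
  have h_id := surjSubm_id (𝓜.base (fun x => E.q (p x)) (E.hq.comp hp))
  refine ⟨_, _, fun x => x, hp', h_id, fun _ => rfl, ⟨?_⟩⟩
  let I := (ExtIso.refl (𝓜.transport E).ext).pullbackAlongTrans hp'
    ((pullbackComp B' _ (𝓜.transport E).hq _ _).trans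
      (pullbackCongr B' _ ((𝓜.transport (E.pullback p hp)).hq.comp h_id) fun _ => rfl))
  let J := ((ExtIso.refl (E.pullback p hp).ext).pullbackAlongTrans
    (𝓜.surjSubm_α _ (E.hq.comp hp)) (𝓜.baseIso _ _)).pullbackAlongTrans h_id
      (pullbackComp B' _ (𝓜.transport (E.pullback p hp)).hq _ _)
  refine I.trans (ExtIso.trans (ExtIso.mapCongr _ fun z =>
    Iso.toFun_eq_toFun _ _ rfl rfl ?_) J.symm)
  have hs : 𝓜.f (FP.snd (PB.src z)) = B.s (PB.mid (PB.mid z)) :=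
    (FP.w (PB.src z)).symm.trans ((congrArg E.q (PB.ws z)).trans (PB.ws (PB.mid z)))
  have ht : B.t (PB.mid (PB.mid z)) = 𝓜.f (FP.snd (PB.tgt z)) :=
    (PB.wt (PB.mid z)).trans ((congrArg E.q (PB.wt z)).trans (FP.w (PB.tgt z)))
  -- both sides unfold to this component, but unification does not find it
  trans PB.mid (𝓜.Φ.toFun (PB.mk (FP.snd (PB.src z)) (PB.mid (PB.mid z)) (FP.snd (PB.tgt z)) hs ht))
  · rfl
  · rfl

theorem moritaEq_symm_transport_transport (E : ExtOver C B) :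
    MoritaEq (𝓜.symm.transport (𝓜.transport E)) E := by
  let X := 𝓜.symm.transport (𝓜.transport E)
  let I := (ExtIso.refl (𝓜.transport E).ext).pullbackAlongTrans
    (𝓜.symm.surjSubm_α _ (𝓜.transport E).hq) (𝓜.symm.baseIso _ _)
  let Y := FP X.q E.q X.hq.subm E.hq.smooth
  let y₁ : Y → X.M := FP.fst
  let y₂ : Y → E.M := FP.snd
  have hy₁ : SurjSubm y₁ := FP.surjSubm_fst X.hq.subm E.hq
  have hy₂ : SurjSubm y₂ := FP.surjSubm_snd X.hq E.hq.smooth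
  -- a point of `Y` is `((m, t), t')` together with `y₂`, where `q m = f t`, `g t = g t'` and
  -- `f t' = q y₂`
  let m (y : Y) : E.M := 𝓜.α E.q E.hq (𝓜.symm.α _ (𝓜.transport E).hq (y₁ y))
  let t (y : Y) : 𝓜.T := 𝓜.β E.q E.hq (𝓜.symm.α _ (𝓜.transport E).hq (y₁ y))
  let t' (y : Y) : 𝓜.T := 𝓜.symm.β _ (𝓜.transport E).hq (y₁ y)
  have hα := (𝓜.symm.surjSubm_α _ (𝓜.transport E).hq).comp hy₁
  have hm : SurjSubm m := (𝓜.surjSubm_α E.q E.hq).comp hα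
  have ht : SurjSubm t := (𝓜.surjSubm_β E.q E.hq).comp hα
  have ht' : SurjSubm t' := (𝓜.symm.surjSubm_β _ (𝓜.transport E).hq).comp hy₁
  have hmt (y) : E.q (m y) = 𝓜.f (t y) := FP.w (𝓜.symm.α _ (𝓜.transport E).hq (y₁ y))
  have htt' (y) : 𝓜.g (t y) = 𝓜.g (t' y) := FP.w (y₁ y)
  have ht'y (y) : 𝓜.f (t' y) = E.q (y₂ y) := FP.w y
  let c : ArrowFamily (B.pullback E.q E.hq) m y₂ :=
    (𝓜.link ht.smooth ht'.smooth htt').mid.toPullback E.hq hm.smooth hy₂.smooth hmt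
      fun y => (ht'y y).symm
  refine moritaEq_of_arrowFamily I hy₁ hy₂ ht'y c fun z => ?_
  let r : (B.pullback 𝓜.f 𝓜.hf).arr := PB.mk (t (PB.src z)) (PB.mid (PB.mid z)) (t (PB.tgt z))
    ((hmt _).symm.trans ((congrArg E.q (PB.ws z)).trans (PB.ws (PB.mid z))))
    ((PB.wt (PB.mid z)).trans ((congrArg E.q (PB.wt z)).trans (hmt _)))
  -- `baseIso` for `𝓜` and then for its inverse applies `Φ`, moves the end points from `t` to `t'`
  -- and applies the inverse of `Φ`
  exact congrArg PB.mid (𝓜.mid_conj_link ht ht' htt' (PB.mk (PB.src z) r (PB.tgt z) rfl rfl)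
    ((htt' _).symm.trans ((congrArg 𝓜.g (𝓜.Φ.mor.s_map r)).symm.trans (PB.ws _)))
    ((PB.wt _).trans ((congrArg 𝓜.g (𝓜.Φ.mor.t_map r)).trans (htt' _))))

theorem mk_transport_eq {E E' : ExtOver C B} (h : MoritaEq E E') :
    Gerbe.mk (𝓜.transport E) = Gerbe.mk (𝓜.transport E') := by
  obtain ⟨M'', p, p', hp, hp', h, ⟨I⟩⟩ := h
  calc Gerbe.mk (𝓜.transport E) = Gerbe.mk (𝓜.transport (E.pullback p hp)) :=
        Quot.sound (𝓜.moritaEq_transport_pullback E p hp)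
    _ = Gerbe.mk (𝓜.transport (E'.pullback p' hp')) := Quot.sound (𝓜.moritaEq_transport h I)
    _ = Gerbe.mk (𝓜.transport E') := (Quot.sound (𝓜.moritaEq_transport_pullback E' p' hp')).symm

/-- The map `[E] ↦ [𝓜_* E]` on gerbes induced by a Morita equivalence. -/
noncomputable def gerbeMap : Gerbe C B → Gerbe C B' :=
  Quot.lift (fun E => Gerbe.mk (𝓜.transport E)) fun _ _ => 𝓜.mk_transport_eq

theorem symm_gerbeMap_gerbeMap (x : Gerbe C B) : 𝓜.symm.gerbeMap (𝓜.gerbeMap x) = x :=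
  Quot.inductionOn x fun E => Quot.sound (𝓜.moritaEq_symm_transport_transport E)

end MoritaEquiv

end LieGroupoid

theorem mainTheorem7 {B₀ B₀' : Mfd.{u}} (C : CrossedModule.{u}) (B : LieGroupoid B₀)
    (B' : LieGroupoid B₀') (𝓜 : LieGroupoid.MoritaEquiv B B') :
    ∃ F : LieGroupoid.Gerbe C B ≃ LieGroupoid.Gerbe C B',
      (∀ E : LieGroupoid.ExtOver C B,
        F (LieGroupoid.Gerbe.mk E) = LieGroupoid.Gerbe.mk (𝓜.transport E)) ∧
      (∀ E' : LieGroupoid.ExtOver C B',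
        F.symm (LieGroupoid.Gerbe.mk E') = LieGroupoid.Gerbe.mk (𝓜.symm.transport E')) := by
  exact ⟨⟨𝓜.gerbeMap, 𝓜.symm.gerbeMap, 𝓜.symm_gerbeMap_gerbeMap,
    𝓜.symm.symm_gerbeMap_gerbeMap⟩, fun _ => rfl, fun _ => rfl⟩
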